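/- For a finite abelian group $G$, a quadratic form is a map $q:G\to\mathbb{Q}/\mathbb{Z}$ such that $b(x,y)=q(x+y)-q(x)-q(y)+q(0)$ is bilinear. It is non-degenerate if $b$ is, and homogeneous if $q(nx)=n^2q(x)$ for all $n\in\mathbb{Z}$. Write $q\sim q'$ if there is $\Delta\in G$ with $q(g)=q'(g-\Delta)$ for all $g\in G$, let $[q]$ be the equivalence class of $q$, and put $\tau^+(G,q)=|G|^{-1/2}\sum_{g\in G}e^{2\pi i q(g)}$. Let $\mathsf{ASCS}$ be the groupoid whose objects are tuples $(\mathscr{D},[q],\sigma)$ consisting of a finite abelian group $\mathscr{D}$, a class $[q]$ of non-degenerate quadratic forms $q:\mathscr{D}\to\mathbb{Q}/\mathbb{Z}$ and $\sigma\in\mathbb{Z}/8$ with $\tau^+(\mathscr{D},q)=e^{2\pi i\sigma/8}$, and whose morphisms $(\mathscr{D}_1,[q_1],\sigma_1)\to(\mathscr{D}_2,[q_2],\sigma_2)$ are the group isomorphisms $\phi:\mathscr{D}_1\to\mathscr{D}_2$ with $[q_2\circ\phi]=[q_1]$. A tuple is called spin if no representative $q$ of $[q]$ satisfies $q(0)=0$;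 let $\mathsf{ASCS}^{\mathrm{spin}}\subset\mathsf{ASCS}$ be the full subgroupoid of spin tuples. Let $\mathsf{PSM}$ be the groupoid of pointed spin-modular data: objects are tuples $(G,\hat q,f)$ with $G$ a finite abelian group, $\hat q:G\to\mathbb{Q}/\mathbb{Z}$ a non-degenerate homogeneous quadratic form and $f\in G$ with $2f=0$ and $\hat q(f)=\tfrac12$; morphisms $(G_1,\hat q_1,f_1)\to(G_2,\hat q_2,f_2)$ are the group isomorphisms $\phi:G_1\to G_2$ with $\hat q_2\circ\phi=\hat q_1$ and $\phi(f_1)=f_2$. For $(G,\hat q,f)\in\mathsf{PSM}$ with bilinear form $\hat b$ put $G_0=\{g\in G\mid\hat b(g,f)=0\}$ and $\mathscr{D}=G_0/\langle f\rangle$; choose $a\in G\setminus G_0$ and put $q_a([x])=\hat q(x-a)$ for $x\in G_0$; and let $\sigma\in\mathbb{Z}/8$ be determined by $\tau^+(G,\hat q)=e^{2\pi i\sigma/8}$. Let $F(G,\hat q,f)=(\mathscr{D},[q_a],\sigma)$, and for a morphism $\phi$ let $F(\phi)$ be the induced isomorphism of the quotients $G_0/\langle f\rangle$. Then: 1. $F$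 is a well-defined functor $\mathsf{PSM}\to\mathsf{ASCS}$. In detail: $G/G_0\cong\mathbb{Z}/2$, $q_a$ is a well-defined non-degenerate quadratic form on $\mathscr{D}$, its class $[q_a]$ does not depend on $a$, $\sigma$ exists and is unique, $\tau^+(\mathscr{D},q_a)=e^{2\pi i\sigma/8}$, and induced isomorphisms preserve the classes. 2. $F$ is essentially surjective, full and $2:1$ on morphisms (for all $X,Y\in\mathsf{PSM}$ every morphism $F(X)\to F(Y)$ has exactly two preimages in $\mathrm{Hom}(X,Y)$). It induces a bijection between the isomorphism classes of objects of $\mathsf{PSM}$ and of $\mathsf{ASCS}$. 3. $F(G,\hat q,f)$ is spin if and only if $\hat q(g)\neq0$ for all $g\in G\setminus G_0$. With $\mathsf{PSM}^{\mathrm{spin}}\subset\mathsf{PSM}$ the full subgroupoid of such objects, the restriction $F:\mathsf{PSM}^{\mathrm{spin}}\to\mathsf{ASCS}^{\mathrm{spin}}$ is also essentially surjective, full and $2:1$ on morphisms, and induces a bijection on isomorphism classes. -/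

import Mathlib

open CategoryTheory

universe u

noncomputable section

namespace SpinCS

/-- The group `ℚ/ℤ`. -/
abbrev QZ : Type := AddCircle (1 : ℚ)

/-- The element `1/2` of `ℚ/ℤ`. -/
def half : QZ := ((1 / 2 : ℚ) : QZ)

/-- The character `ℚ/ℤ → ℂ`, `r ↦ exp (2πi r)`. -/
def expQZ : QZ → ℂ :=
  Function.Periodic.lift (f := fun r : ℚ => Complex.exp (2 * Real.pi * Complex.I * (r : ℂ)))
    (c := (1 : ℚ)) (fun r => by
      push_cast
      rw [mul_add, mul_one, Complex.exp_add, Complex.exp_two_pi_mul_I, mul_one])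

section QuadraticForms

/-- A (not necessarily homogeneous, not necessarily normalised) quadratic form `q : G → ℚ/ℤ`:
`b(x, y) = q(x + y) - q(x) - q(y) + q(0)` is required to be biadditive. -/
@[ext]
structure QuadForm (G : Type u) [AddCommGroup G] where
  toFun : G → QZ
  add_left' : ∀ x x' y : G,
    toFun (x + x' + y) - toFun (x + x') - toFun y + toFun 0 =
      (toFun (x + y) - toFun x - toFun y + toFun 0) +
        (toFun (x' + y) - toFun x' - toFun y + toFun 0)
  add_right' : ∀ x y y' : G,
    toFun (x + (y + y')) - toFun x - toFun (y + y') + toFun 0 =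
      (toFun (x + y) - toFun x - toFun y + toFun 0) +
        (toFun (x + y') - toFun x - toFun y' + toFun 0)

namespace QuadForm

variable {G : Type u} [AddCommGroup G] {H : Type u} [AddCommGroup H]

instance : CoeFun (QuadForm G) (fun _ => G → QZ) := ⟨QuadForm.toFun⟩

/-- The bilinear form `b` associated to `q`. -/
def b (q : QuadForm G) (x y : G) : QZ := q (x + y) - q x - q y + q 0

theorem b_add_left (q : QuadForm G) (x x' y : G) : q.b (x + x') y = q.b x y + q.b x' y :=
  q.add_left' x x' y

theorem b_add_right (q : QuadForm G) (x y y' : G) : q.b x (y + y') = q.b x y + q.b x y' :=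
  q.add_right' x y y'

theorem b_zero_left (q : QuadForm G) (y : G) : q.b 0 y = 0 := by
  simp [b]

theorem b_neg_left (q : QuadForm G) (x y : G) : q.b (-x) y = - q.b x y := by
  have h := q.b_add_left (-x) x y
  rw [neg_add_cancel, b_zero_left] at h
  exact eq_neg_of_add_eq_zero_left h.symm

/-- `q` is non-degenerate if its bilinear form is. -/
def Nondegenerate (q : QuadForm G) : Prop := ∀ x : G, (∀ y : G, q.b x y = 0) → x = 0

/-- `q` is homogeneous if `q(n x) = n² q(x)` for all integers `n`. -/
def Homogeneous (q : QuadForm G) : Prop := ∀ (n : ℤ) (x : G), q (n • x) = n ^ 2 • q x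

/-- The pullback `q ∘ φ` along a group isomorphism. -/
def comap (φ : G ≃+ H) (q : QuadForm H) : QuadForm G where
  toFun x := q (φ x)
  add_left' x x' y := by simpa using q.add_left' (φ x) (φ x') (φ y)
  add_right' x y y' := by simpa using q.add_right' (φ x) (φ y) (φ y')

/-- The Gauss sum `τ⁺(G, q) = |G|^(-1/2) ∑_g exp (2πi q(g))` (for finite `G`). -/
def gaussSum (q : QuadForm G) : ℂ :=
  (1 / (Real.sqrt (Nat.card G : ℝ) : ℂ)) * ∑ᶠ g : G, expQZ (q g)

/-- `q ∼ q'` if there is `Δ` with `q(g) = q'(g - Δ)` for all `g`. -/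
def Shift (q q' : QuadForm G) : Prop := ∃ Δ : G, ∀ g : G, q g = q' (g - Δ)

variable (G) in
instance shiftSetoid : Setoid (QuadForm G) where
  r := Shift
  iseqv :=
    { refl := fun q => ⟨0, fun g => by simp⟩
      symm := by
        rintro q q' ⟨Δ, h⟩
        exact ⟨-Δ, fun g => by rw [h]; simp⟩
      trans := by
        rintro q q' q'' ⟨Δ, h⟩ ⟨Δ', h'⟩
        exact ⟨Δ + Δ', fun g => by rw [h, h', sub_sub]⟩ }

end QuadForm

/-- Equivalence classes `[q]` of quadratic forms up to translation. -/
def QuadClass (G : Type u) [AddCommGroup G] : Type u := Quotient (QuadForm.shiftSetoid G)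

namespace QuadClass

variable {G : Type u} [AddCommGroup G] {H : Type u} [AddCommGroup H] {K : Type u} [AddCommGroup K]

/-- The class `[q]`. -/
def mk (q : QuadForm G) : QuadClass G := Quotient.mk (QuadForm.shiftSetoid G) q

/-- The class `[q ∘ φ]` of a class `[q]`, for a group isomorphism `φ`. -/
def comap (φ : G ≃+ H) (c : QuadClass H) : QuadClass G :=
  Quotient.map' (QuadForm.comap φ)
    (by
      rintro q q' ⟨Δ, h⟩
      refine ⟨φ.symm Δ, fun g => ?_⟩
      change q (φ g) = q' (φ (g - φ.symm Δ))
      rw [h, map_sub, AddEquiv.apply_symm_apply]) c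

theorem comap_refl (c : QuadClass G) : c.comap (AddEquiv.refl G) = c := by
  induction c using Quotient.inductionOn
  rfl

theorem comap_trans (φ : G ≃+ H) (ψ : H ≃+ K) (c : QuadClass K) :
    c.comap (φ.trans ψ) = (c.comap ψ).comap φ := by
  induction c using Quotient.inductionOn
  rfl

/-- The class consists of non-degenerate forms. -/
def Nondegenerate (c : QuadClass G) : Prop := ∀ q : QuadForm G, mk q = c → q.Nondegenerate

/-- The Gauss–Milgram constraint `τ⁺(G, q) = exp (2πi σ / 8)` for the forms `q` in the class. -/
def GaussMilgram (c : QuadClass G) (σ : ZMod 8) : Prop :=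
  ∀ q : QuadForm G, mk q = c → q.gaussSum = ZMod.stdAddChar σ

/-- No form `q` in the class satisfies `q(0) = 0`. -/
def Spin (c : QuadClass G) : Prop := ∀ q : QuadForm G, mk q = c → q 0 ≠ 0

end QuadClass

end QuadraticForms

section ChernSimonsData

/-- Tuples `(𝒟, [q], σ mod 8)` of abelian (spin) Chern–Simons data: a finite abelian group, a
translation class of non-degenerate quadratic forms and a residue mod `8`, subject to the
Gauss–Milgram constraint. -/
structure ASCS : Type (u + 1) where
  D : Type u
  [grp : AddCommGroup D]
  [fin : Finite D]
  cls : QuadClass D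
  σ : ZMod 8
  nondegenerate : cls.Nondegenerate
  gaussMilgram : cls.GaussMilgram σ

namespace ASCS

attribute [instance] ASCS.grp ASCS.fin

/-- Morphisms: group isomorphisms `φ` with `[q₂ ∘ φ] = [q₁]`. -/
@[ext]
structure Hom (X Y : ASCS.{u}) where
  φ : X.D ≃+ Y.D
  map_cls : Y.cls.comap φ = X.cls

instance : Groupoid ASCS.{u} where
  Hom := Hom
  id X := ⟨AddEquiv.refl X.D, QuadClass.comap_refl _⟩
  comp f g := ⟨f.φ.trans g.φ, by rw [QuadClass.comap_trans, g.map_cls, f.map_cls]⟩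
  inv f := ⟨f.φ.symm, by
    rw [← f.map_cls, ← QuadClass.comap_trans, AddEquiv.symm_trans_self, QuadClass.comap_refl]⟩
  inv_comp f := Hom.ext (AddEquiv.symm_trans_self f.φ)
  comp_inv f := Hom.ext (AddEquiv.self_trans_symm f.φ)

/-- A tuple is spin if no representative `q` of `[q]` satisfies `q(0) = 0`. -/
def isSpin : ObjectProperty ASCS.{u} := fun X => X.cls.Spin

end ASCS

end ChernSimonsData

section PointedSpinModular

/-- Objects `(G, q̂, f)`: a finite abelian group, a non-degenerate homogeneous quadratic form and
a fermion `f`, i.e. `2 f = 0` and `q̂(f) = 1/2`. -/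
structure PSM : Type (u + 1) where
  G : Type u
  [grp : AddCommGroup G]
  [fin : Finite G]
  q : QuadForm G
  homogeneous : q.Homogeneous
  nondegenerate : q.Nondegenerate
  f : G
  two_f : 2 • f = 0
  q_f : q f = half

namespace PSM

attribute [instance] PSM.grp PSM.fin

/-- Morphisms: group isomorphisms `φ` with `q̂₂ ∘ φ = q̂₁` and `φ(f₁) = f₂`. -/
@[ext]
structure Hom (X Y : PSM.{u}) where
  φ : X.G ≃+ Y.G
  map_q : ∀ g, Y.q (φ g) = X.q g
  map_f : φ X.f = Y.f

instance : Groupoid PSM.{u} where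
  Hom := Hom
  id X := ⟨AddEquiv.refl X.G, fun _ => rfl, rfl⟩
  comp f g := ⟨f.φ.trans g.φ, fun x => by
    rw [AddEquiv.trans_apply, g.map_q, f.map_q], by
    rw [AddEquiv.trans_apply, f.map_f, g.map_f]⟩
  inv f := ⟨f.φ.symm, fun x => by
    rw [← f.map_q, AddEquiv.apply_symm_apply], by
    rw [← f.map_f, AddEquiv.symm_apply_apply]⟩
  inv_comp f := Hom.ext (AddEquiv.symm_trans_self f.φ)
  comp_inv f := Hom.ext (AddEquiv.self_trans_symm f.φ)

/-- The subgroup `G₀ = {g | b̂(g, f) = 0}`. -/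
def G₀ (X : PSM.{u}) : AddSubgroup X.G where
  carrier := {g | X.q.b g X.f = 0}
  zero_mem' := X.q.b_zero_left _
  add_mem' := by
    intro x y hx hy
    simp only [Set.mem_ofPred_eq] at hx hy ⊢
    rw [X.q.b_add_left, hx, hy, add_zero]
  neg_mem' := by
    intro x hx
    simp only [Set.mem_ofPred_eq] at hx ⊢
    rw [X.q.b_neg_left, hx, neg_zero]

theorem mem_G₀ (X : PSM.{u}) (g : X.G) : g ∈ X.G₀ ↔ X.q.b g X.f = 0 := Iff.rfl

theorem q_zero (X : PSM.{u}) : X.q 0 = 0 := by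
  simpa using X.homogeneous 0 0

theorem half_add_half : half + half = 0 := by
  rw [half, ← QuotientAddGroup.mk_add, AddCircle.coe_eq_zero_iff]
  exact ⟨1, by norm_num⟩

theorem half_ne_zero : half ≠ 0 := by
  rw [half, Ne, AddCircle.coe_eq_zero_iff]
  rintro ⟨n, hn⟩
  simp only [zsmul_eq_mul, mul_one] at hn
  have h2 : ((2 * n : ℤ) : ℚ) = ((1 : ℤ) : ℚ) := by push_cast; linarith
  have h3 : 2 * n = 1 := by exact_mod_cast h2
  omega

theorem eq_zero_or_eq_half (t : QZ) (h : t + t = 0) : t = 0 ∨ t = half := by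
  induction t using QuotientAddGroup.induction_on with
  | H r =>
    rw [← QuotientAddGroup.mk_add, AddCircle.coe_eq_zero_iff] at h
    obtain ⟨n, hn⟩ := h
    simp only [zsmul_eq_mul, mul_one] at hn
    rcases Int.even_or_odd' n with ⟨m, hm | hm⟩
    · left
      rw [AddCircle.coe_eq_zero_iff]
      refine ⟨m, ?_⟩
      rw [hm] at hn
      push_cast at hn
      simp only [zsmul_eq_mul, mul_one]
      linarith
    · right
      rw [half, ← sub_eq_zero, ← QuotientAddGroup.mk_sub, AddCircle.coe_eq_zero_iff]
      refine ⟨m, ?_⟩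
      rw [hm] at hn
      push_cast at hn
      simp only [zsmul_eq_mul, mul_one]
      linarith

theorem f_mem (X : PSM.{u}) : X.f ∈ X.G₀ := by
  rw [mem_G₀, QuadForm.b, ← two_nsmul, X.two_f, X.q_f, X.q_zero, add_zero, zero_sub,
    sub_eq_add_neg, ← neg_add, half_add_half, neg_zero]

/-- `f` as an element of `G₀`. -/
def f₀ (X : PSM.{u}) : X.G₀ := ⟨X.f, X.f_mem⟩

/-- The group `𝒟 = G₀ / ⟨f⟩`. -/
abbrev D (X : PSM.{u}) : Type u := X.G₀ ⧸ AddSubgroup.zmultiples X.f₀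

instance (X : PSM.{u}) : Finite X.D := Quotient.finite _

theorem b_f_of_notMem (X : PSM.{u}) {a : X.G} (ha : a ∉ X.G₀) : X.q.b a X.f = half := by
  refine (eq_zero_or_eq_half _ ?_).resolve_left ha
  rw [← X.q.b_add_right, ← two_nsmul, X.two_f]
  simp [QuadForm.b]

theorem q_add_f (X : PSM.{u}) {c : X.G} (hc : c ∉ X.G₀) : X.q (c + X.f) = X.q c := by
  have h := X.b_f_of_notMem hc
  rw [QuadForm.b, X.q_f, X.q_zero, add_zero, sub_sub, sub_eq_iff_eq_add, add_comm (X.q c),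
    ← add_assoc, half_add_half, zero_add] at h
  exact h

theorem q_sub_eq (X : PSM.{u}) {a : X.G} (ha : a ∉ X.G₀) (x y : X.G₀)
    (hxy : -x + y ∈ AddSubgroup.zmultiples X.f₀) :
    X.q ((x : X.G) - a) = X.q ((y : X.G) - a) := by
  have key : ∀ z : X.G₀, (z : X.G) - a ∉ X.G₀ := fun z hz =>
    ha (by simpa using X.G₀.sub_mem z.2 hz)
  obtain ⟨k, hk⟩ := AddSubgroup.mem_zmultiples_iff.1 hxy
  have hk' : (y : X.G) = x + k • X.f := by
    have := congrArg (fun z : X.G₀ => (z : X.G)) hk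
    simp only [f₀, AddSubgroup.coe_zsmul, AddSubgroup.coe_add, AddSubgroup.coe_neg] at this
    rw [this]
    abel
  have h2 : (2 : ℤ) • X.f = 0 := by
    have := X.two_f
    rwa [← natCast_zsmul] at this
  rcases Int.even_or_odd' k with ⟨m, hm | hm⟩
  · rw [hk', hm, mul_comm, mul_zsmul, h2, zsmul_zero, add_zero]
  · rw [hk', hm, add_zsmul, mul_comm, mul_zsmul, h2, zsmul_zero, one_zsmul, zero_add,
      add_sub_right_comm, X.q_add_f (key x)]

/-- The quadratic form `q_a([x]) = q̂(x - a)` on `𝒟`, for `a ∉ G₀`. -/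
def qa (X : PSM.{u}) (a : X.G) (ha : a ∉ X.G₀) : QuadForm X.D where
  toFun := Quotient.lift (fun x : X.G₀ => X.q ((x : X.G) - a)) (fun x y h =>
    X.q_sub_eq ha x y (QuotientAddGroup.leftRel_apply.1 h))
  add_left' := by
    intro x x' y
    induction x using QuotientAddGroup.induction_on with | H x => ?_
    induction x' using QuotientAddGroup.induction_on with | H x' => ?_
    induction y using QuotientAddGroup.induction_on with | H y => ?_
    change X.q (((x + x' + y : X.G₀) : X.G) - a) - X.q (((x + x' : X.G₀) : X.G) - a)
        - X.q ((y : X.G) - a) + X.q (((0 : X.G₀) : X.G) - a) =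
      (X.q (((x + y : X.G₀) : X.G) - a) - X.q ((x : X.G) - a)
        - X.q ((y : X.G) - a) + X.q (((0 : X.G₀) : X.G) - a)) +
      (X.q (((x' + y : X.G₀) : X.G) - a) - X.q ((x' : X.G) - a)
        - X.q ((y : X.G) - a) + X.q (((0 : X.G₀) : X.G) - a))
    push_cast
    have h1 := X.q.b_add_left (x : X.G) (x' - a) y
    have h2 := X.q.b_add_left (x' : X.G) (-a) y
    have h3 := X.q.b_add_left (x : X.G) (-a) y
    rw [← sub_eq_add_neg] at h2 h3
    simp only [QuadForm.b, ← add_sub_assoc, zero_sub, neg_add_eq_sub, sub_add_eq_add_sub]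
      at h1 h2 h3 ⊢
    grind
  add_right' := by
    intro x y y'
    induction x using QuotientAddGroup.induction_on with | H x => ?_
    induction y using QuotientAddGroup.induction_on with | H y => ?_
    induction y' using QuotientAddGroup.induction_on with | H y' => ?_
    change X.q (((x + (y + y') : X.G₀) : X.G) - a) - X.q ((x : X.G) - a)
        - X.q (((y + y' : X.G₀) : X.G) - a) + X.q (((0 : X.G₀) : X.G) - a) =
      (X.q (((x + y : X.G₀) : X.G) - a) - X.q ((x : X.G) - a)
        - X.q ((y : X.G) - a) + X.q (((0 : X.G₀) : X.G) - a)) +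
      (X.q (((x + y' : X.G₀) : X.G) - a) - X.q ((x : X.G) - a)
        - X.q ((y' : X.G) - a) + X.q (((0 : X.G₀) : X.G) - a))
    push_cast
    have h1 := X.q.b_add_right (x : X.G) (y - a) y'
    have h2 := X.q.b_add_right (x : X.G) (-a) y
    have h3 := X.q.b_add_right (x : X.G) (-a) y'
    simp only [QuadForm.b, ← add_sub_assoc, ← sub_eq_add_neg, zero_sub, neg_add_eq_sub,
      sub_add_eq_add_sub, ← add_assoc] at h1 h2 h3 ⊢
    grind

@[simp]
theorem qa_mk (X : PSM.{u}) (a : X.G) (ha : a ∉ X.G₀) (x : X.G₀) :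
    X.qa a ha (QuotientAddGroup.mk x) = X.q ((x : X.G) - a) := rfl

theorem exists_notMem (X : PSM.{u}) : ∃ a : X.G, a ∉ X.G₀ := by
  by_contra! h
  have h0 : X.f = 0 := X.nondegenerate X.f fun y => by
    have hy := (X.mem_G₀ y).1 (h y)
    rw [QuadForm.b] at hy ⊢
    rw [add_comm X.f y, sub_right_comm, hy]
  exact half_ne_zero (by rw [← X.q_f, h0, X.q_zero])

/-- The class `[q_a]` on `𝒟`, for a chosen `a ∉ G₀`. -/
def qClass (X : PSM.{u}) : QuadClass X.D :=
  QuadClass.mk (X.qa X.exists_notMem.choose X.exists_notMem.choose_spec)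

/-- No `g ∉ G₀` has `q̂(g) = 0`. -/
def isSpin : ObjectProperty PSM.{u} := fun X => ∀ g : X.G, g ∉ X.G₀ → X.q g ≠ 0

namespace Hom

theorem map_b {X Y : PSM.{u}} (φ : Hom X Y) (x y : X.G) :
    Y.q.b (φ.φ x) (φ.φ y) = X.q.b x y := by
  rw [QuadForm.b, QuadForm.b, ← map_add, φ.map_q, φ.map_q, φ.map_q, X.q_zero, Y.q_zero]

theorem map_mem_iff {X Y : PSM.{u}} (φ : Hom X Y) (x : X.G) : φ.φ x ∈ Y.G₀ ↔ x ∈ X.G₀ := by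
  rw [mem_G₀, mem_G₀, ← φ.map_f, φ.map_b]

/-- The isomorphism of the subgroups `G₀` obtained by restriction. -/
def map₀ {X Y : PSM.{u}} (φ : Hom X Y) : X.G₀ ≃+ Y.G₀ where
  toFun x := ⟨φ.φ x, (φ.map_mem_iff x).2 x.2⟩
  invFun y := ⟨φ.φ.symm y, (φ.map_mem_iff _).1 (by
    rw [AddEquiv.apply_symm_apply]
    exact y.2)⟩
  left_inv x := by simp
  right_inv y := by simp
  map_add' x y := by
    ext
    simp

/-- The induced isomorphism `[x] ↦ [φ(x)]` of the quotients `𝒟 = G₀ / ⟨f⟩`. -/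
def mapD {X Y : PSM.{u}} (φ : Hom X Y) : X.D ≃+ Y.D :=
  QuotientAddGroup.congr _ _ φ.map₀ (by
    rw [AddMonoidHom.map_zmultiples]
    congr 1
    exact Subtype.ext φ.map_f)

@[simp]
theorem mapD_mk {X Y : PSM.{u}} (φ : Hom X Y) (x : X.G₀) :
    φ.mapD (QuotientAddGroup.mk x) = QuotientAddGroup.mk (φ.map₀ x) := rfl

end Hom

end PSM

end PointedSpinModular

section TheFunctor

/-- All the facts which make the assignment
`(G, q̂, f) ↦ (G₀ / ⟨f⟩, [q_a], σ)`, `φ ↦` (induced isomorphism), well defined. -/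
structure WellDefined : Prop where
  /-- `G / G₀` has two elements. -/
  index_eq_two : ∀ X : PSM.{u}, X.G₀.index = 2
  /-- The class `[q_a]` does not depend on `a`. -/
  class_eq : ∀ (X : PSM.{u}) (a : X.G) (ha : a ∉ X.G₀), QuadClass.mk (X.qa a ha) = X.qClass
  /-- The class `[q_a]` is non-degenerate. -/
  nondegenerate : ∀ X : PSM.{u}, X.qClass.Nondegenerate
  /-- `τ⁺(G, q̂) = exp (2πi σ / 8)` determines `σ` in `ℤ/8`. -/
  existsUnique_σ : ∀ X : PSM.{u}, ∃! σ : ZMod 8, X.q.gaussSum = ZMod.stdAddChar σ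
  /-- This `σ` satisfies the Gauss–Milgram constraint for `[q_a]`. -/
  gaussMilgram : ∀ (X : PSM.{u}) (σ : ZMod 8), X.q.gaussSum = ZMod.stdAddChar σ →
    X.qClass.GaussMilgram σ
  /-- The isomorphism induced by a morphism respects the classes. -/
  map_class : ∀ (X Y : PSM.{u}) (φ : PSM.Hom X Y), Y.qClass.comap φ.mapD = X.qClass

/-- The functor `F`, given that it is well defined. -/
def F (h : WellDefined.{u}) : PSM.{u} ⥤ ASCS.{u} where
  obj X :=
    { D := X.D
      cls := X.qClass
      σ := (h.existsUnique_σ X).choose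
      nondegenerate := h.nondegenerate X
      gaussMilgram := h.gaussMilgram X _ (h.existsUnique_σ X).choose_spec.1 }
  map {X Y} φ := (⟨PSM.Hom.mapD φ, h.map_class X Y φ⟩ : ASCS.Hom _ _)
  map_id X := by
    refine ASCS.Hom.ext (AddEquiv.ext fun d => ?_)
    induction d using QuotientAddGroup.induction_on
    rfl
  map_comp φ ψ := by
    refine ASCS.Hom.ext (AddEquiv.ext fun d => ?_)
    induction d using QuotientAddGroup.induction_on
    rfl

/-- The restriction of `F` to spin objects, given that `F` preserves them. -/
def Fspin (h : WellDefined.{u}) (hs : ∀ X : PSM.{u}, PSM.isSpin X → ASCS.isSpin ((F h).obj X)) :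
    PSM.isSpin.{u}.FullSubcategory ⥤ ASCS.isSpin.{u}.FullSubcategory :=
  ASCS.isSpin.lift (PSM.isSpin.ι ⋙ F h) (fun X => hs X.obj X.property)

end TheFunctor

section Generalities

variable {C : Type*} [Category C] {C' : Type*} [Category C']

/-- A functor is `2:1` on morphisms: for all `X`, `Y`, every morphism `F X ⟶ F Y` has exactly two
preimages in `X ⟶ Y`. -/
def TwoToOneOnHoms (F : C ⥤ C') : Prop :=
  ∀ (X Y : C) (g : F.obj X ⟶ F.obj Y), Nat.card {k : X ⟶ Y // F.map k = g} = 2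

/-- Isomorphism classes of objects. -/
def IsoClasses (C : Type*) [Category C] := Quotient (isIsomorphicSetoid C)

/-- The map on isomorphism classes induced by a functor. -/
def mapIsoClasses (F : C ⥤ C') : IsoClasses C → IsoClasses C' :=
  Quotient.map F.obj (fun _ _ ⟨e⟩ => ⟨F.mapIso e⟩)

end Generalities

end SpinCS

end

/-! ### The exponential on `ℚ/ℤ`. -/

namespace SpinCS

/-! Well-definedness. Since `q̂(f) = 1/2`, translation by `f` changes the sign of `exp (2πi q̂)` on
`G₀` and preserves it off `G₀`. So the Gauss sum of `q̂` lives on `G ∖ G₀`, where it is a positive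
multiple of that of `q_a`; both have modulus one after normalisation, hence agree
(`PSM.gaussSum_qa`). That `τ⁺(G, q̂)` is an eighth root of unity follows from Lagrange's four-square
theorem: a quaternion of norm `|G|² - 1` permutes `G⁴` and negates `q̂ ⊕ q̂ ⊕ q̂ ⊕ q̂`, so the
fourth power of the Gauss sum is real (`Homogeneous.gaussSum_pow_eight`).

Fullness and `2:1`. The representatives of the class are exactly the `q_c` with `c ∉ G₀`, and `c` is
determined by `q_c` up to adding `f`. For `ψ` respecting classes, `q_a` is carried to some `q_c`, so
a lift of `ψ` must send `a` to `c` or `c + f`. Each choice is realised by exactly one lift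
(`exists_hom_of_qa_eq`, `Hom.ext_of_mapD_eq`).

Essential surjectivity. If `q = q_a`, an element `y + n a` with `y ∈ G₀` is recorded by `x = [y]`,
`t = b̂(y, a)` and `n`. Put `w = [-2a]`. Then `2t = -b(w, x)` and `q̂(y + n a) = q(x) - q(0) + t + n
t + n² q(0)`, while `y = -2a` gives the relation `(w, -4 q(0), 2) = 0`. Conversely, these formulas
define `(G, q̂, f)` from `q` once `q(x) - q(-x) = b(w, x)`, `q(-w) = q(0)` and `8 q(0) = b(w, w)`
(`CharForm`). The first two hold for every non-degenerate `q`; the third is what the Gauss–Milgram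
constraint supplies (`Nondegenerate.exists_charForm`). -/

theorem expQZ_coe (r : ℚ) :
    expQZ (r : QZ) = Complex.exp (2 * Real.pi * Complex.I * (r : ℂ)) := rfl

theorem expQZ_add (s t : QZ) : expQZ (s + t) = expQZ s * expQZ t := by
  induction s using QuotientAddGroup.induction_on with | H s => ?_
  induction t using QuotientAddGroup.induction_on with | H t => ?_
  rw [← QuotientAddGroup.mk_add]
  simp only [expQZ_coe]
  rw [← Complex.exp_add]
  push_cast
  ring_nf

@[simp]
theorem expQZ_zero : expQZ 0 = 1 := by
  have := expQZ_coe 0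
  simpa using this

theorem norm_expQZ (t : QZ) : ‖expQZ t‖ = 1 := by
  induction t using QuotientAddGroup.induction_on with | H t => ?_
  rw [expQZ_coe, Complex.norm_exp]
  simp

theorem expQZ_neg (t : QZ) : expQZ (-t) = (starRingEnd ℂ) (expQZ t) := by
  have h : expQZ (-t) * expQZ t = 1 := by rw [← expQZ_add, neg_add_cancel, expQZ_zero]
  have h' : (starRingEnd ℂ) (expQZ t) * expQZ t = 1 := by
    rw [mul_comm, Complex.mul_conj, Complex.normSq_eq_norm_sq, norm_expQZ]
    simp
  exact mul_right_cancel₀ (right_ne_zero_of_mul_eq_one h) (h.trans h'.symm)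

theorem eq_zero_of_expQZ_eq_one {t : QZ} (h : expQZ t = 1) : t = 0 := by
  induction t using QuotientAddGroup.induction_on with | H t => ?_
  rw [expQZ_coe, Complex.exp_eq_one_iff] at h
  obtain ⟨n, hn⟩ := h
  rw [mul_comm (n : ℂ)] at hn
  have h2 := mul_left_cancel₀ Complex.two_pi_I_ne_zero hn
  have h3 : t = (n : ℚ) := by exact_mod_cast h2
  rw [AddCircle.coe_eq_zero_iff]
  exact ⟨n, by simp [h3]⟩

theorem expQZ_injective : Function.Injective expQZ := fun s t h => by
  rw [← sub_eq_zero]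
  apply eq_zero_of_expQZ_eq_one
  rw [sub_eq_add_neg, expQZ_add, h, ← expQZ_add, add_neg_cancel, expQZ_zero]

theorem expQZ_half : expQZ half = -1 := by
  rw [half, expQZ_coe, ← Complex.exp_pi_mul_I]
  push_cast
  ring_nf

theorem expQZ_nsmul (n : ℕ) (t : QZ) : expQZ (n • t) = expQZ t ^ n := by
  induction n with
  | zero => simp
  | succ n ih => rw [succ_nsmul, expQZ_add, ih, pow_succ]

theorem sum_pow_four {α : Type*} [Fintype α] (f : α → ℂ) :
    (∑ g, f g) ^ 4 = ∑ p : α × α × α × α, f p.1 * f p.2.1 * f p.2.2.1 * f p.2.2.2 := by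
  simp only [Fintype.sum_prod_type, pow_succ, pow_zero, one_mul, Finset.mul_sum, Finset.sum_mul]
  refine Finset.sum_congr rfl fun x _ => Finset.sum_congr rfl fun y _ =>
    Finset.sum_congr rfl fun z _ => Finset.sum_congr rfl fun t _ => ?_
  ring

/-! ### Bilinear forms, characters and Gauss sums. -/

namespace QuadForm

variable {G : Type u} [AddCommGroup G] {H : Type u} [AddCommGroup H] (q : QuadForm G)

theorem b_comm (x y : G) : q.b x y = q.b y x := by
  rw [b, b, add_comm x y]
  abel

theorem b_zero_right (x : G) : q.b x 0 = 0 := by rw [b_comm, b_zero_left]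

theorem b_neg_right (x y : G) : q.b x (-y) = -q.b x y := by rw [b_comm, b_neg_left, b_comm]

theorem b_sub_left (x y z : G) : q.b (x - y) z = q.b x z - q.b y z := by
  rw [sub_eq_add_neg, b_add_left, b_neg_left, ← sub_eq_add_neg]

theorem b_sub_right (x y z : G) : q.b x (y - z) = q.b x y - q.b x z := by
  rw [sub_eq_add_neg, b_add_right, b_neg_right, ← sub_eq_add_neg]

/-- `y ↦ b(x, y)` as a homomorphism. -/
def bHom (x : G) : G →+ QZ where
  toFun := q.b x
  map_zero' := q.b_zero_right x
  map_add' := q.b_add_right x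

theorem b_zsmul_right (n : ℤ) (x y : G) : q.b x (n • y) = n • q.b x y :=
  map_zsmul (q.bHom x) n y

theorem b_zsmul_left (n : ℤ) (x y : G) : q.b (n • x) y = n • q.b x y := by
  rw [b_comm, b_zsmul_right, b_comm]

theorem map_add (x y : G) : q (x + y) = q x + q y - q 0 + q.b x y := by
  rw [b]
  abel

/-- `y ↦ exp (2πi b(x, y))` as an additive character. -/
noncomputable def bChar (x : G) : AddChar G ℂ where
  toFun y := expQZ (q.b x y)
  map_zero_eq_one' := by rw [b_zero_right, expQZ_zero]
  map_add_eq_mul' y y' := by rw [b_add_right, expQZ_add]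

theorem bChar_apply (x y : G) : q.bChar x y = expQZ (q.b x y) := rfl

variable {q}

theorem Nondegenerate.bChar_injective (hq : q.Nondegenerate) : Function.Injective q.bChar := by
  intro x x' h
  rw [← sub_eq_zero]
  refine hq _ fun y => ?_
  have := expQZ_injective (DFunLike.congr_fun h y)
  rw [b_sub_left, this, sub_self]

/-- Every homomorphism to `ℚ/ℤ` is represented by a non-degenerate form. -/
theorem Nondegenerate.exists_b_eq [Finite G] (hq : q.Nondegenerate) (h : G →+ QZ) :
    ∃ w : G, ∀ x, h x = q.b w x := by
  have := Fintype.ofFinite G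
  -- Non-degeneracy embeds `G` in its character group, which has the same order.
  have hb : Function.Bijective q.bChar := by
    rw [Nat.bijective_iff_injective_and_card]
    refine ⟨hq.bChar_injective, ?_⟩
    rw [Nat.card_eq_fintype_card, Nat.card_eq_fintype_card, AddChar.card_eq]
  let χ : AddChar G ℂ :=
    { toFun := fun y => expQZ (h y)
      map_zero_eq_one' := by rw [map_zero, expQZ_zero]
      map_add_eq_mul' := fun y y' => by rw [_root_.map_add, expQZ_add] }
  obtain ⟨w, hw⟩ := hb.2 χ
  exact ⟨w, fun x => expQZ_injective (DFunLike.congr_fun hw x).symm⟩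

variable (q)

theorem gaussSum_eq [Fintype G] :
    q.gaussSum = (1 / (Real.sqrt (Fintype.card G : ℝ) : ℂ)) * ∑ g, expQZ (q g) := by
  rw [gaussSum, Nat.card_eq_fintype_card, finsum_eq_sum_of_fintype]

variable {q}

/-- Substituting `x = y + d` turns the sum over `y` into a sum of the character `b(d, ·)`, which
vanishes unless `d = 0`. -/
theorem Nondegenerate.sum_mul_conj [Fintype G] (hq : q.Nondegenerate) :
    (∑ g, expQZ (q g)) * (starRingEnd ℂ) (∑ g, expQZ (q g)) = Fintype.card G := by
  classical
  have key : ∀ d : G, ∑ y, expQZ (q (y + d)) * expQZ (-q y) =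
      if d = 0 then (Fintype.card G : ℂ) else 0 := by
    intro d
    have : ∀ y, expQZ (q (y + d)) * expQZ (-q y) = expQZ (q d - q 0) * q.bChar d y := by
      intro y
      rw [bChar_apply, ← expQZ_add, ← expQZ_add, map_add, b_comm q d]
      congr 1
      abel
    simp_rw [this, ← Finset.mul_sum]
    split_ifs with h
    · subst h
      simp [bChar_apply, b_zero_left]
    · rw [AddChar.sum_eq_zero_of_ne_one, mul_zero]
      intro h1
      refine h (hq.bChar_injective ?_)
      rw [h1]
      ext y
      simp [bChar_apply, b_zero_left]
  rw [map_sum, Finset.sum_mul_sum, Finset.sum_comm]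
  simp_rw [← expQZ_neg]
  calc ∑ y, ∑ x, expQZ (q x) * expQZ (-q y)
      = ∑ y, ∑ d, expQZ (q (y + d)) * expQZ (-q y) := by
        refine Finset.sum_congr rfl fun y _ => ?_
        exact (Equiv.sum_comp (Equiv.addLeft y) fun x => expQZ (q x) * expQZ (-q y)).symm
    _ = _ := by
        rw [Finset.sum_comm]
        simp [key]

theorem Nondegenerate.gaussSum_mul_conj [Finite G] (hq : q.Nondegenerate) :
    q.gaussSum * (starRingEnd ℂ) q.gaussSum = 1 := by
  have := Fintype.ofFinite G
  rw [gaussSum_eq, map_mul, mul_mul_mul_comm, hq.sum_mul_conj, map_div₀, map_one,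
    Complex.conj_ofReal, div_mul_div_comm, ← Complex.ofReal_mul,
    Real.mul_self_sqrt (Nat.cast_nonneg _)]
  have : (Fintype.card G : ℂ) ≠ 0 := Nat.cast_ne_zero.2 Fintype.card_ne_zero
  simp [this]

theorem Nondegenerate.gaussSum_ne_zero [Finite G] (hq : q.Nondegenerate) : q.gaussSum ≠ 0 :=
  left_ne_zero_of_mul_eq_one hq.gaussSum_mul_conj

theorem Homogeneous.map_zero (hq : q.Homogeneous) : q 0 = 0 := by
  simpa using hq 0 0

theorem Homogeneous.map_add (hq : q.Homogeneous) (x y : G) : q (x + y) = q x + q y + q.b x y := by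
  rw [QuadForm.map_add, hq.map_zero, sub_zero]

theorem Homogeneous.map_neg (hq : q.Homogeneous) (x : G) : q (-x) = q x := by
  simpa using hq (-1) x

theorem Homogeneous.map_sub (hq : q.Homogeneous) (x y : G) : q (x - y) = q x + q y - q.b x y := by
  rw [sub_eq_add_neg, hq.map_add, hq.map_neg, b_neg_right, ← sub_eq_add_neg]

theorem Homogeneous.map_comb (hq : q.Homogeneous) (a b c d : ℤ) (x y z t : G) :
    q (a • x + b • y + c • z + d • t) =
      a ^ 2 • q x + b ^ 2 • q y + c ^ 2 • q z + d ^ 2 • q t +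
      ((a * b) • q.b x y + (a * c) • q.b x z + (a * d) • q.b x t + (b * c) • q.b y z +
        (b * d) • q.b y t + (c * d) • q.b z t) := by
  simp only [hq.map_add, hq a, hq b, hq c, hq d, b_add_left, b_zsmul_left, b_zsmul_right]
  module

/-- Multiplication by the quaternion `a + bi + cj + dk` on `G⁴`. -/
def quaternionMul (a b c d : ℤ) (p : G × G × G × G) : G × G × G × G :=
  (a • p.1 + (-b) • p.2.1 + (-c) • p.2.2.1 + (-d) • p.2.2.2,
    b • p.1 + a • p.2.1 + (-d) • p.2.2.1 + c • p.2.2.2,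
    c • p.1 + d • p.2.1 + a • p.2.2.1 + (-b) • p.2.2.2,
    d • p.1 + (-c) • p.2.1 + b • p.2.2.1 + a • p.2.2.2)

theorem quaternionMul_conj (a b c d : ℤ) (p : G × G × G × G) :
    quaternionMul a (-b) (-c) (-d) (quaternionMul a b c d p) =
      (a ^ 2 + b ^ 2 + c ^ 2 + d ^ 2) • p := by
  obtain ⟨x, y, z, t⟩ := p
  simp only [quaternionMul, Prod.smul_mk, Prod.mk.injEq]
  refine ⟨?_, ?_, ?_, ?_⟩ <;> module

theorem Homogeneous.map_quaternionMul (hq : q.Homogeneous) (a b c d : ℤ) (p : G × G × G × G) :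
    q (quaternionMul a b c d p).1 + q (quaternionMul a b c d p).2.1 +
        q (quaternionMul a b c d p).2.2.1 + q (quaternionMul a b c d p).2.2.2 =
      (a ^ 2 + b ^ 2 + c ^ 2 + d ^ 2) • (q p.1 + q p.2.1 + q p.2.2.1 + q p.2.2.2) := by
  simp only [quaternionMul, hq.map_comb]
  module

/-- Both sides are sums over `G⁴`, matched by multiplication by a quaternion whose norm acts as `-1`
on `G` and on the values of `q`. -/
theorem Homogeneous.conj_sum_pow_four [Fintype G] (hq : q.Homogeneous) :
    (starRingEnd ℂ) (∑ g, expQZ (q g)) ^ 4 = (∑ g, expQZ (q g)) ^ 4 := by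
  have hN : 0 < Fintype.card G ^ 2 := pow_pos Fintype.card_pos 2
  -- The square is needed: `|G|` kills `G` but not always the values of `q`, while `|G|² q(x) =
  -- q(|G| x) = 0`.
  obtain ⟨a, b, c, d, h⟩ := Nat.sum_four_squares (Fintype.card G ^ 2 - 1)
  have hz : ((a : ℤ) ^ 2 + (b : ℤ) ^ 2 + (c : ℤ) ^ 2 + (d : ℤ) ^ 2) =
      (Fintype.card G : ℤ) ^ 2 - 1 := by
    have : a ^ 2 + b ^ 2 + c ^ 2 + d ^ 2 + 1 = Fintype.card G ^ 2 := by omega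
    rw [eq_sub_iff_add_eq]
    exact_mod_cast this
  have hG : ∀ x : G, ((Fintype.card G : ℤ) ^ 2 - 1) • x = -x := fun x => by
    rw [sub_zsmul, pow_two, mul_zsmul, natCast_zsmul, card_nsmul_eq_zero]
    simp
  have hQ : ∀ x : G, ((Fintype.card G : ℤ) ^ 2 - 1) • q x = -q x := fun x => by
    rw [sub_zsmul, ← hq, natCast_zsmul, card_nsmul_eq_zero, hq.map_zero]
    simp
  -- Following by the conjugate quaternion gives the norm, that is `-1`, so the map is injective.
  have hb : Function.Bijective (quaternionMul (G := G) a b c d) := by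
    rw [← Finite.injective_iff_bijective]
    intro p p' hp
    have h1 := congrArg (quaternionMul (a : ℤ) (-b) (-c) (-d)) hp
    rw [quaternionMul_conj, quaternionMul_conj, hz] at h1
    obtain ⟨x, y, z, t⟩ := p
    obtain ⟨x', y', z', t'⟩ := p'
    simpa only [Prod.smul_mk, hG, Prod.mk.injEq, neg_inj] using h1
  rw [map_sum, sum_pow_four, sum_pow_four]
  refine Fintype.sum_bijective _ hb _ _ fun p => ?_
  simp only [← expQZ_neg, ← expQZ_add]
  rw [hq.map_quaternionMul, hz]
  simp only [smul_add, hQ]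

theorem Homogeneous.gaussSum_pow_eight [Finite G] (hq : q.Homogeneous) (hn : q.Nondegenerate) :
    q.gaussSum ^ 8 = 1 := by
  have := Fintype.ofFinite G
  have h : (starRingEnd ℂ) q.gaussSum ^ 4 = q.gaussSum ^ 4 := by
    rw [gaussSum_eq, map_mul, mul_pow, mul_pow, hq.conj_sum_pow_four, map_div₀, map_one,
      Complex.conj_ofReal]
  calc q.gaussSum ^ 8 = q.gaussSum ^ 4 * q.gaussSum ^ 4 := by ring
    _ = (q.gaussSum * (starRingEnd ℂ) q.gaussSum) ^ 4 := by rw [mul_pow, h]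
    _ = 1 := by rw [hn.gaussSum_mul_conj, one_pow]

theorem gaussSum_comap [Finite H] (φ : G ≃+ H) (q : QuadForm H) :
    (comap φ q).gaussSum = q.gaussSum := by
  have := Fintype.ofFinite H
  have := Fintype.ofEquiv H φ.symm.toEquiv
  rw [gaussSum_eq, gaussSum_eq, Fintype.card_congr φ.toEquiv]
  congr 1
  exact Equiv.sum_comp φ.toEquiv fun h => expQZ (q h)

theorem Shift.gaussSum_eq [Finite G] {q q' : QuadForm G} (h : Shift q q') :
    q.gaussSum = q'.gaussSum := by
  have := Fintype.ofFinite G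
  obtain ⟨Δ, h⟩ := h
  rw [QuadForm.gaussSum_eq, QuadForm.gaussSum_eq]
  simp_rw [h]
  congr 1
  exact Equiv.sum_comp (Equiv.subRight Δ) fun g => expQZ (q' g)

theorem Shift.b_eq {q q' : QuadForm G} (h : Shift q q') : q.b = q'.b := by
  obtain ⟨Δ, h⟩ := h
  ext x y
  have h1 := q'.b_add_right x (y - Δ) (-(-Δ))
  have h2 := q'.b_neg_right x (-Δ)
  simp only [b] at h1 h2 ⊢
  simp only [h, ← add_sub_assoc, zero_sub, neg_neg, sub_add_cancel, ← sub_eq_add_neg] at h1 h2 ⊢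
  grind

end QuadForm

namespace QuadClass

variable {G : Type u} [AddCommGroup G]

theorem mk_eq_mk {q q' : QuadForm G} : mk q = mk q' ↔ QuadForm.Shift q q' := Quotient.eq

theorem nondegenerate_mk {q : QuadForm G} (hq : q.Nondegenerate) : (mk q).Nondegenerate := by
  intro q' h x hx
  exact hq x fun y => by rw [← (mk_eq_mk.1 h).b_eq, hx]

theorem gaussMilgram_mk [Finite G] {q : QuadForm G} {σ : ZMod 8}
    (hq : q.gaussSum = ZMod.stdAddChar σ) : (mk q).GaussMilgram σ := by
  intro q' h
  rw [(mk_eq_mk.1 h).gaussSum_eq, hq]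

theorem comap_mk {H : Type u} [AddCommGroup H] (φ : G ≃+ H) (q : QuadForm H) :
    (mk q).comap φ = mk (q.comap φ) := rfl

end QuadClass

theorem stdAddChar_pow_eight (σ : ZMod 8) : (ZMod.stdAddChar σ : ℂ) ^ 8 = 1 := by
  rw [← AddChar.map_nsmul_eq_pow]
  have : 8 • σ = 0 := by revert σ; decide
  rw [this, AddChar.map_zero_eq_one]

theorem exists_stdAddChar_eq {z : ℂ} (hz : z ^ 8 = 1) : ∃ σ : ZMod 8, z = ZMod.stdAddChar σ := by
  obtain ⟨i, _, hi⟩ := (Complex.isPrimitiveRoot_exp 8 (by norm_num)).eq_pow_of_pow_eq_one hz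
  refine ⟨(i : ZMod 8), ?_⟩
  have := ZMod.stdAddChar_coe (N := 8) (i : ℤ)
  push_cast at this
  rw [this, ← hi, ← Complex.exp_nat_mul]
  congr 1
  push_cast
  ring

/-! ### The quotient `G₀ / ⟨f⟩`, the forms `q_a` and their Gauss sums. -/

namespace PSM

variable (X : PSM.{u})

theorem add_mem_of_notMem {a c : X.G} (ha : a ∉ X.G₀) (hc : c ∉ X.G₀) : a + c ∈ X.G₀ := by
  rw [mem_G₀, X.q.b_add_left, X.b_f_of_notMem ha, X.b_f_of_notMem hc, half_add_half]

theorem sub_mem_of_notMem {a c : X.G} (ha : a ∉ X.G₀) (hc : c ∉ X.G₀) : a - c ∈ X.G₀ := by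
  rw [mem_G₀, X.q.b_sub_left, X.b_f_of_notMem ha, X.b_f_of_notMem hc, sub_self]

theorem b_f_left {a : X.G} (ha : a ∉ X.G₀) : X.q.b X.f a = half := by
  rw [X.q.b_comm, X.b_f_of_notMem ha]

theorem q_add_f_of_mem {x : X.G} (hx : x ∈ X.G₀) : X.q (x + X.f) = X.q x + half := by
  rw [X.homogeneous.map_add, (X.mem_G₀ x).1 hx, X.q_f, add_zero]

theorem index_G₀ : X.G₀.index = 2 := by
  obtain ⟨a, ha⟩ := X.exists_notMem
  refine AddSubgroup.index_eq_two_iff.2 ⟨a, fun c => ?_⟩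
  by_cases hc : c ∈ X.G₀
  · exact Or.inr ⟨hc, fun h => ha ((X.G₀.add_mem_cancel_left hc).1 h)⟩
  · exact Or.inl ⟨X.add_mem_of_notMem hc ha, hc⟩

/-- For `a ∉ G₀` we have `2a ∈ G₀`, so `b(d, a)` is `0` or `1/2`; in the second case `d - f` pairs
to zero with `G₀` and with `a`. As `G₀` and `a` generate `G`, non-degeneracy concludes. -/
theorem eq_zero_or_eq_f {d : X.G} (h : ∀ y ∈ X.G₀, X.q.b d y = 0) : d = 0 ∨ d = X.f := by
  obtain ⟨a, ha⟩ := X.exists_notMem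
  have hsplit : ∀ e : X.G, (∀ y ∈ X.G₀, X.q.b e y = 0) → X.q.b e a = 0 → e = 0 := by
    intro e he hea
    refine X.nondegenerate e fun g => ?_
    by_cases hg : g ∈ X.G₀
    · exact he g hg
    · have := he _ (X.sub_mem_of_notMem hg ha)
      rwa [X.q.b_sub_right, hea, sub_zero] at this
  have h2 : X.q.b d a + X.q.b d a = 0 := by
    rw [← X.q.b_add_right]
    exact h _ (X.add_mem_of_notMem ha ha)
  rcases eq_zero_or_eq_half _ h2 with h0 | h0
  · exact Or.inl (hsplit d h h0)
  · refine Or.inr (sub_eq_zero.1 (hsplit _ (fun y hy => ?_) ?_))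
    · rw [X.q.b_sub_left, h y hy, X.q.b_comm, (X.mem_G₀ y).1 hy, sub_zero]
    · rw [X.q.b_sub_left, h0, X.b_f_left ha, sub_self]

theorem qa_b_mk (a : X.G) (ha : a ∉ X.G₀) (x y : X.G₀) :
    (X.qa a ha).b (QuotientAddGroup.mk x) (QuotientAddGroup.mk y) = X.q.b x y := by
  have h0 : X.qa a ha 0 = X.q ((0 : X.G₀) - a) := rfl
  rw [QuadForm.b, ← QuotientAddGroup.mk_add, h0]
  simp only [qa_mk, AddSubgroup.coe_add, AddSubgroup.coe_zero, X.homogeneous.map_sub,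
    X.homogeneous.map_add, X.q.b_add_left, X.q.b_zero_left, X.q_zero]
  abel

theorem mk_f₀ : (QuotientAddGroup.mk X.f₀ : X.D) = 0 :=
  (QuotientAddGroup.eq_zero_iff _).2 (AddSubgroup.mem_zmultiples _)

theorem mk_eq_zero {x : X.G₀} : (QuotientAddGroup.mk x : X.D) = 0 ↔ (x : X.G) = 0 ∨ x = X.f := by
  constructor
  · intro h
    obtain ⟨a, ha⟩ := X.exists_notMem
    refine X.eq_zero_or_eq_f fun y hy => ?_
    rw [← X.qa_b_mk a ha x ⟨y, hy⟩, h, QuadForm.b_zero_left]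
  · rintro (h | h)
    · have : x = 0 := Subtype.ext h
      rw [this, QuotientAddGroup.mk_zero]
    · have : x = X.f₀ := Subtype.ext h
      rw [this, mk_f₀]

theorem qa_nondegenerate (a : X.G) (ha : a ∉ X.G₀) : (X.qa a ha).Nondegenerate := by
  intro x hx
  induction x using QuotientAddGroup.induction_on with | H x => ?_
  refine X.mk_eq_zero.2 (X.eq_zero_or_eq_f fun y hy => ?_)
  rw [← X.qa_b_mk a ha x ⟨y, hy⟩, hx]

theorem qa_shift (a c : X.G) (ha : a ∉ X.G₀) (hc : c ∉ X.G₀) :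
    QuadForm.Shift (X.qa a ha) (X.qa c hc) := by
  refine ⟨QuotientAddGroup.mk ⟨a - c, X.sub_mem_of_notMem ha hc⟩, fun g => ?_⟩
  induction g using QuotientAddGroup.induction_on with | H x => ?_
  change X.q (x - a) = X.q (x - (a - c) - c)
  rw [sub_sub, sub_add_cancel]

theorem mk_qa (a : X.G) (ha : a ∉ X.G₀) : QuadClass.mk (X.qa a ha) = X.qClass :=
  QuadClass.mk_eq_mk.2 (X.qa_shift _ _ _ _)

/-- Every form in the class `[q_a]` is some `q_c`. -/
theorem exists_eq_qa {q : QuadForm X.D} (h : QuadClass.mk q = X.qClass) :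
    ∃ (c : X.G) (hc : c ∉ X.G₀), q = X.qa c hc := by
  obtain ⟨a, ha⟩ := X.exists_notMem
  rw [← X.mk_qa a ha] at h
  obtain ⟨Δ, h⟩ := QuadClass.mk_eq_mk.1 h
  induction Δ using QuotientAddGroup.induction_on with | H z => ?_
  refine ⟨z + a, fun h' => ha ((X.G₀.add_mem_cancel_left z.2).1 h'), ?_⟩
  ext x
  induction x using QuotientAddGroup.induction_on with | H x => ?_
  rw [h, ← QuotientAddGroup.mk_sub, qa_mk, qa_mk, AddSubgroup.coe_sub, sub_sub]

/-- Translation by `f` permutes `G₀` and reverses the sign of every term. -/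
theorem sum_mem_G₀ [Fintype X.G] [DecidablePred (· ∈ X.G₀)] :
    ∑ g : X.G with g ∈ X.G₀, expQZ (X.q g) = 0 := by
  have h : ∑ g : X.G with g ∈ X.G₀, expQZ (X.q g) = ∑ g : X.G with g ∈ X.G₀, -expQZ (X.q g) := by
    refine Finset.sum_equiv (Equiv.addRight X.f) (fun g => ?_) (fun g hg => ?_)
    · simp [X.G₀.add_mem_cancel_right X.f_mem]
    · have hg' : g ∈ X.G₀ := by simpa using hg
      rw [Equiv.coe_addRight, X.q_add_f_of_mem hg', expQZ_add, expQZ_half]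
      ring
  rw [Finset.sum_neg_distrib] at h
  exact self_eq_neg.1 h

theorem sum_notMem_G₀ [Fintype X.G] [DecidablePred (· ∈ X.G₀)] (a : X.G) (ha : a ∉ X.G₀) :
    ∑ g : X.G with g ∉ X.G₀, expQZ (X.q g) = ∑ x : X.G₀, expQZ (X.qa a ha x) := by
  symm
  refine Finset.sum_bij (fun x _ => (x : X.G) - a) (fun x _ => ?_) (fun x _ y _ h => ?_)
    (fun g hg => ?_) (fun x _ => rfl)
  · simp only [Finset.mem_filter, Finset.mem_univ, true_and]
    exact fun h => ha (by simpa using X.G₀.sub_mem x.2 h)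
  · exact Subtype.ext (sub_left_inj.1 h)
  · have hg' : g ∉ X.G₀ := by simpa using hg
    exact ⟨⟨g + a, X.add_mem_of_notMem hg' ha⟩, Finset.mem_univ _, add_sub_cancel_right _ _⟩

theorem exists_sum_eq_nsmul [Fintype X.G₀] [Fintype X.D] :
    ∃ k : ℕ, ∀ F : X.D → ℂ, ∑ x : X.G₀, F x = k * ∑ d, F d := by
  classical
  let π := QuotientAddGroup.mk' (AddSubgroup.zmultiples X.f₀)
  have hπ : ∀ d, d ∈ Set.range π := QuotientAddGroup.mk'_surjective _
  refine ⟨(Finset.univ.filter fun x => π x = 0).card, fun F => ?_⟩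
  have h := Finset.sum_fiberwise' Finset.univ π F
  rw [Finset.mul_sum]
  refine h.symm.trans (Finset.sum_congr rfl fun d _ => ?_)
  rw [Finset.sum_const, nsmul_eq_mul,
    AddMonoidHom.card_fiber_eq_of_mem_range π (hπ d) (hπ 0)]

/-- The two normalised sums differ by a nonnegative real factor and both have modulus one, so the
fibre size `k` and the orders of the groups never have to be computed. -/
theorem gaussSum_qa (a : X.G) (ha : a ∉ X.G₀) : (X.qa a ha).gaussSum = X.q.gaussSum := by
  classical
  have := Fintype.ofFinite X.G
  have := Fintype.ofFinite X.D
  obtain ⟨k, hk⟩ := X.exists_sum_eq_nsmul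
  have hsum : ∑ g, expQZ (X.q g) = k * ∑ d, expQZ (X.qa a ha d) := by
    rw [← Finset.sum_filter_add_sum_filter_not _ (· ∈ X.G₀), X.sum_mem_G₀, zero_add,
      X.sum_notMem_G₀ a ha, hk fun d => expQZ (X.qa a ha d)]
  have hD : Real.sqrt (Fintype.card X.D) ≠ 0 :=
    Real.sqrt_ne_zero'.2 (Nat.cast_pos.2 Fintype.card_pos)
  have hD' : (Real.sqrt (Fintype.card X.D) : ℂ) ≠ 0 := Complex.ofReal_ne_zero.2 hD
  obtain ⟨r, hr, h⟩ : ∃ r : ℝ, 0 ≤ r ∧ X.q.gaussSum = r * (X.qa a ha).gaussSum := by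
    refine ⟨k * Real.sqrt (Fintype.card X.D) / Real.sqrt (Fintype.card X.G), by positivity, ?_⟩
    rw [QuadForm.gaussSum_eq, QuadForm.gaussSum_eq, hsum]
    push_cast
    field_simp
  have h1 := X.nondegenerate.gaussSum_mul_conj
  rw [h, map_mul, Complex.conj_ofReal, mul_mul_mul_comm,
    (X.qa_nondegenerate a ha).gaussSum_mul_conj, mul_one] at h1
  have h2 : r * r = 1 := by exact_mod_cast h1
  have h3 : r = 1 := by nlinarith
  rw [h, h3, Complex.ofReal_one, one_mul]

theorem Hom.comap_qa {X Y : PSM.{u}} (φ : Hom X Y) (a : X.G) (ha : a ∉ X.G₀) :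
    (Y.qa (φ.φ a) ((φ.map_mem_iff a).not.2 ha)).comap φ.mapD = X.qa a ha := by
  ext x
  induction x using QuotientAddGroup.induction_on with | H x => ?_
  change Y.q (φ.φ x - φ.φ a) = X.q (x - a)
  rw [← map_sub, φ.map_q]

end PSM

theorem wellDefined : WellDefined.{u} where
  index_eq_two := PSM.index_G₀
  class_eq X a ha := X.mk_qa a ha
  nondegenerate X := QuadClass.nondegenerate_mk (X.qa_nondegenerate _ _)
  existsUnique_σ X := by
    obtain ⟨σ, hσ⟩ := exists_stdAddChar_eq (X.homogeneous.gaussSum_pow_eight X.nondegenerate)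
    exact ⟨σ, hσ, fun σ' h => ZMod.injective_stdAddChar (h.symm.trans hσ)⟩
  gaussMilgram X σ h := QuadClass.gaussMilgram_mk ((X.gaussSum_qa _ _).trans h)
  map_class X Y φ := by
    obtain ⟨a, ha⟩ := X.exists_notMem
    rw [← X.mk_qa a ha, ← Y.mk_qa _ ((φ.map_mem_iff a).not.2 ha), QuadClass.comap_mk, φ.comap_qa]

/-! ### Isomorphisms from isotropic correspondences. -/

namespace QuadForm

variable {G : Type u} [AddCommGroup G] {H : Type u} [AddCommGroup H]

theorem b_eq_of_mem {q : QuadForm G} {q' : QuadForm H} {R : AddSubgroup (G × H)}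
    (hR : ∀ p ∈ R, q' p.2 = q p.1) {p p' : G × H} (hp : p ∈ R) (hp' : p' ∈ R) :
    q'.b p.2 p'.2 = q.b p.1 p'.1 := by
  have h := hR _ (R.add_mem hp hp')
  have h0 := hR _ R.zero_mem
  simp only [Prod.fst_add, Prod.snd_add, Prod.fst_zero, Prod.snd_zero] at h h0
  rw [b, b, h, h0, hR p hp, hR p' hp']

/-- A correspondence between non-degenerate quadratic groups which is isotropic and surjects onto
both factors is the graph of an isomorphism. -/
theorem exists_addEquiv_of_isotropic {q : QuadForm G} {q' : QuadForm H} (hq : q.Nondegenerate)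
    (hq' : q'.Nondegenerate) (R : AddSubgroup (G × H)) (hR : ∀ p ∈ R, q' p.2 = q p.1)
    (h₁ : ∀ g, ∃ h, (g, h) ∈ R) (h₂ : ∀ h, ∃ g, (g, h) ∈ R) :
    ∃ φ : G ≃+ H, ∀ p ∈ R, φ p.1 = p.2 := by
  -- Isotropy transports `b`, so a partner of `0` is orthogonal to everything that occurs as a
  -- second component.
  have u₁ : ∀ h, ((0 : G), h) ∈ R → h = 0 := fun h hh => hq' h fun y => by
    obtain ⟨x, hx⟩ := h₂ y
    exact (b_eq_of_mem hR hh hx).trans (q.b_zero_left x)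
  have u₂ : ∀ g, (g, (0 : H)) ∈ R → g = 0 := fun g hg => hq g fun x => by
    obtain ⟨y, hy⟩ := h₁ x
    exact (b_eq_of_mem hR hg hy).symm.trans (q'.b_zero_left y)
  choose F hF using h₁
  have hF' : ∀ p ∈ R, F p.1 = p.2 := fun p hp => by
    have := R.sub_mem (hF p.1) hp
    rw [← sub_eq_zero]
    exact u₁ _ (by simpa [Prod.ext_iff] using (show (p.1, F p.1) - p = (0, F p.1 - p.2) by
      ext <;> simp) ▸ this)
  let φ : G →+ H := AddMonoidHom.mk' F fun x y => hF' _ (R.add_mem (hF x) (hF y))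
  have hφ : Function.Bijective φ := by
    refine ⟨(injective_iff_map_eq_zero φ).2 fun g hg => u₂ g ?_, fun h => ?_⟩
    · have := hF g
      rwa [show F g = 0 from hg] at this
    · obtain ⟨g, hg⟩ := h₂ h
      exact ⟨g, hF' _ hg⟩
  exact ⟨AddEquiv.ofBijective φ hφ, hF'⟩

end QuadForm

/-! ### Lifting isomorphisms of `𝒟`: existence and the count of two. -/

namespace PSM

variable {X Y : PSM.{u}}

/-- On `G₀` the two maps differ by `0` or `f`. The difference is orthogonal to the common image of
`a`, and `f` is not, so they agree on `G₀` and at `a`. -/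
theorem Hom.ext_of_mapD_eq {φ φ' : Hom X Y} {a : X.G} (ha : a ∉ X.G₀) (h : φ.φ a = φ'.φ a)
    (hD : φ.mapD = φ'.mapD) : φ = φ' := by
  have h₀ : ∀ x ∈ X.G₀, φ.φ x = φ'.φ x := by
    intro x hx
    have hx' : (QuotientAddGroup.mk (φ.map₀ ⟨x, hx⟩ - φ'.map₀ ⟨x, hx⟩) : Y.D) = 0 := by
      rw [QuotientAddGroup.mk_sub, ← mapD_mk, ← mapD_mk, hD, sub_self]
    rw [← sub_eq_zero]
    refine (Y.mk_eq_zero.1 hx').resolve_right fun hf => half_ne_zero ?_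
    have hf' : φ.φ x - φ'.φ x = Y.f := hf
    rw [← Y.b_f_left ((φ.map_mem_iff a).not.2 ha), ← hf', Y.q.b_sub_left, φ.map_b, h, φ'.map_b,
      sub_self]
  refine Hom.ext (AddEquiv.ext fun g => ?_)
  by_cases hg : g ∈ X.G₀
  · exact h₀ g hg
  · have := h₀ _ (X.sub_mem_of_notMem hg ha)
    rwa [map_sub, map_sub, h, sub_left_inj] at this

section Lift

variable (ψ : X.D ≃+ Y.D) (a : X.G) (c : Y.G)

/-- The correspondence between `G₁` and `G₂` generated by `(a, c)` and the pairs `(x, y)` in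
`G₀ × G₀` with `ψ[x] = [y]` and `b(y, c) = b(x, a)`. -/
def correspondence : AddSubgroup (X.G × Y.G) where
  carrier := {p | ∃ (n : ℤ) (x : X.G₀) (y : Y.G₀), ψ (QuotientAddGroup.mk x) =
    QuotientAddGroup.mk y ∧ Y.q.b y c = X.q.b x a ∧ p = (x + n • a, y + n • c)}
  zero_mem' := ⟨0, 0, 0, by simp, by simp [QuadForm.b_zero_left], by ext <;> simp⟩
  add_mem' := by
    rintro _ _ ⟨n, x, y, h, hb, rfl⟩ ⟨n', x', y', h', hb', rfl⟩
    refine ⟨n + n', x + x', y + y', ?_, ?_, ?_⟩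
    · rw [QuotientAddGroup.mk_add, QuotientAddGroup.mk_add, map_add, h, h']
    · rw [AddSubgroup.coe_add, AddSubgroup.coe_add, QuadForm.b_add_left, QuadForm.b_add_left, hb,
        hb']
    · ext <;> simp only [Prod.fst_add, Prod.snd_add, AddSubgroup.coe_add] <;> module
  neg_mem' := by
    rintro _ ⟨n, x, y, h, hb, rfl⟩
    refine ⟨-n, -x, -y, ?_, ?_, ?_⟩
    · rw [QuotientAddGroup.mk_neg, QuotientAddGroup.mk_neg, map_neg, h]
    · rw [AddSubgroup.coe_neg, AddSubgroup.coe_neg, QuadForm.b_neg_left, QuadForm.b_neg_left, hb]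
    · ext <;> simp only [Prod.fst_neg, Prod.snd_neg, AddSubgroup.coe_neg] <;> module

/-- Thus `q_a` determines `b(x, a)` up to `1/2`, which is the ambiguity of lifting `[x]` to `G₀`. -/
theorem qa_sub_qa_neg (X : PSM.{u}) (a : X.G) (ha : a ∉ X.G₀) (x : X.G₀) :
    X.qa a ha (QuotientAddGroup.mk x) - X.qa a ha (-QuotientAddGroup.mk x) =
      -(X.q.b x a + X.q.b x a) := by
  rw [← QuotientAddGroup.mk_neg, qa_mk, qa_mk, AddSubgroup.coe_neg, X.homogeneous.map_sub,
    X.homogeneous.map_sub, X.homogeneous.map_neg, X.q.b_neg_left]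
  abel

variable {ψ a c}

/-- For a correct choice of the lift `y` of `ψ[x]`, the pairings with `a` and `c` agree. -/
theorem exists_lift {ha : a ∉ X.G₀} {hc : c ∉ Y.G₀}
    (hψ : ∀ d, Y.qa c hc (ψ d) = X.qa a ha d) (x : X.G₀) (y : Y.G₀)
    (h : ψ (QuotientAddGroup.mk x) = QuotientAddGroup.mk y) :
    Y.q.b y c = X.q.b x a ∨ Y.q.b y c + half = X.q.b x a := by
  have hX := X.qa_sub_qa_neg a ha x
  rw [← hψ, ← hψ, map_neg, h, Y.qa_sub_qa_neg, neg_inj] at hX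
  have h2 : (X.q.b x a - Y.q.b y c) + (X.q.b x a - Y.q.b y c) = 0 := by
    rw [sub_add_sub_comm, hX, sub_self]
  rcases eq_zero_or_eq_half _ h2 with h0 | h0
  · exact Or.inl (sub_eq_zero.1 h0).symm
  · exact Or.inr (by rw [← h0, add_sub_cancel])

/-- The graph of the lift is `correspondence ψ a c`. It is isotropic because `q_a([x])`, `q̂(a)` and
`b(x, a)` determine `q̂(x + n a)`. It surjects onto both factors because adding `f` to a
representative changes its pairing with `a` or `c` by `1/2`, correcting any mismatch. -/
theorem exists_hom_of_qa_eq {ha : a ∉ X.G₀} {hc : c ∉ Y.G₀}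
    (hψ : ∀ d, Y.qa c hc (ψ d) = X.qa a ha d) : ∃ φ : Hom X Y, φ.φ a = c ∧ φ.mapD = ψ := by
  have hac : Y.q c = X.q a := by
    have := hψ 0
    rw [map_zero] at this
    change Y.q (0 - c) = X.q (0 - a) at this
    rwa [zero_sub, zero_sub, X.homogeneous.map_neg, Y.homogeneous.map_neg] at this
  have hR : ∀ p ∈ correspondence ψ a c, Y.q p.2 = X.q p.1 := by
    rintro _ ⟨n, x, y, h, hb, rfl⟩
    have hxy := hψ (QuotientAddGroup.mk x)
    rw [h, qa_mk, qa_mk, Y.homogeneous.map_sub, X.homogeneous.map_sub, hb, hac, sub_left_inj,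
      add_left_inj] at hxy
    simp only
    rw [Y.homogeneous.map_add, X.homogeneous.map_add, Y.homogeneous n, X.homogeneous n, hac, hxy,
      QuadForm.b_zsmul_right, QuadForm.b_zsmul_right, hb]
  have hmem : (a, c) ∈ correspondence ψ a c :=
    ⟨1, 0, 0, by simp, by simp [QuadForm.b_zero_left], by simp⟩
  have hmem₀ : ∀ (x : X.G₀) (y : Y.G₀), ψ (QuotientAddGroup.mk x) = QuotientAddGroup.mk y →
      Y.q.b y c = X.q.b x a → ((x : X.G), (y : Y.G)) ∈ correspondence ψ a c := fun x y h hb =>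
    ⟨0, x, y, h, hb, by simp⟩
  have hx : ∀ x : X.G₀, ∃ y : Y.G₀, ψ (QuotientAddGroup.mk x) = QuotientAddGroup.mk y ∧
      ((x : X.G), (y : Y.G)) ∈ correspondence ψ a c := by
    intro x
    obtain ⟨y, hy⟩ := QuotientAddGroup.mk_surjective (ψ (QuotientAddGroup.mk x))
    rcases exists_lift hψ x y hy.symm with h | h
    · exact ⟨y, hy.symm, hmem₀ x y hy.symm h⟩
    · have hy' : ψ (QuotientAddGroup.mk x) = QuotientAddGroup.mk (y + Y.f₀) := by
        rw [QuotientAddGroup.mk_add, mk_f₀, add_zero, hy]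
      refine ⟨_, hy', hmem₀ x _ hy' ?_⟩
      rw [← h, AddSubgroup.coe_add, QuadForm.b_add_left]
      congr 1
      exact Y.b_f_left hc
  have hy : ∀ y : Y.G₀, ∃ x : X.G, (x, (y : Y.G)) ∈ correspondence ψ a c := by
    intro y
    obtain ⟨x, hx⟩ := QuotientAddGroup.mk_surjective (ψ.symm (QuotientAddGroup.mk y))
    have hy : ψ (QuotientAddGroup.mk x) = QuotientAddGroup.mk y := by
      rw [hx, AddEquiv.apply_symm_apply]
    rcases exists_lift hψ x y hy with h | h
    · exact ⟨x, hmem₀ x y hy h⟩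
    · refine ⟨(x + X.f₀ : X.G₀), hmem₀ _ y ?_ ?_⟩
      · rw [QuotientAddGroup.mk_add, mk_f₀, add_zero, hy]
      · have hf : X.q.b X.f₀ a = half := X.b_f_left ha
        rw [AddSubgroup.coe_add, QuadForm.b_add_left, ← h, hf, add_assoc, half_add_half, add_zero]
  obtain ⟨φ, hφ⟩ := QuadForm.exists_addEquiv_of_isotropic X.nondegenerate Y.nondegenerate
    (correspondence ψ a c) hR
    (fun g => by
      by_cases hg : g ∈ X.G₀
      · obtain ⟨y, -, h⟩ := hx ⟨g, hg⟩
        exact ⟨y, h⟩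
      · obtain ⟨y, -, h⟩ := hx ⟨g - a, X.sub_mem_of_notMem hg ha⟩
        refine ⟨y + c, ?_⟩
        simpa using AddSubgroup.add_mem _ h hmem)
    (fun g => by
      by_cases hg : g ∈ Y.G₀
      · exact hy ⟨g, hg⟩
      · obtain ⟨x, h⟩ := hy ⟨g - c, Y.sub_mem_of_notMem hg hc⟩
        refine ⟨x + a, ?_⟩
        simpa using AddSubgroup.add_mem _ h hmem)
  have hf : ((X.f₀ : X.G), (Y.f₀ : Y.G)) ∈ correspondence ψ a c := by
    refine hmem₀ _ _ ?_ ?_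
    · rw [mk_f₀, mk_f₀, map_zero]
    · exact (Y.b_f_left hc).trans (X.b_f_left ha).symm
  have hφq : ∀ g, Y.q (φ g) = X.q g := by
    intro g
    by_cases hg : g ∈ X.G₀
    · obtain ⟨y, -, h⟩ := hx ⟨g, hg⟩
      rw [show φ g = y from hφ _ h]
      exact hR _ h
    · obtain ⟨y, -, h⟩ := hx ⟨g - a, X.sub_mem_of_notMem hg ha⟩
      have h' := AddSubgroup.add_mem _ h hmem
      have hg' := hφ _ h'
      have hq := hR _ h'
      simp only [Prod.mk_add_mk, sub_add_cancel] at hg' hq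
      rw [hg', hq]
  refine ⟨⟨φ, hφq, hφ _ hf⟩, hφ _ hmem, AddEquiv.ext fun d => ?_⟩
  induction d using QuotientAddGroup.induction_on with | H x => ?_
  obtain ⟨y, h, hxy⟩ := hx x
  rw [h, Hom.mapD_mk]
  congr 1
  exact Subtype.ext (hφ _ hxy)

/-- Equality of the forms makes `c' - c` orthogonal to `G₀`. -/
theorem eq_or_eq_add_f {c c' : Y.G} (hc : c ∉ Y.G₀) (hc' : c' ∉ Y.G₀)
    (h : Y.qa c hc = Y.qa c' hc') : c' = c ∨ c' = c + Y.f := by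
  have h' : ∀ y ∈ Y.G₀, Y.q (y - c) = Y.q (y - c') := fun y hy =>
    congrArg (fun q : QuadForm Y.D => q (QuotientAddGroup.mk (⟨y, hy⟩ : Y.G₀))) h
  have h0 : Y.q c = Y.q c' := by
    simpa [Y.homogeneous.map_neg] using h' 0 Y.G₀.zero_mem
  have := Y.eq_zero_or_eq_f (d := c' - c) fun y hy => by
    have := h' y hy
    rw [Y.homogeneous.map_sub, Y.homogeneous.map_sub, h0, sub_right_inj] at this
    rw [Y.q.b_comm, Y.q.b_sub_right, this, sub_self]
  rwa [sub_eq_zero, sub_eq_iff_eq_add'] at this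

theorem qa_add_f {c : Y.G} (hc : c ∉ Y.G₀) (hc' : c + Y.f ∉ Y.G₀) :
    Y.qa (c + Y.f) hc' = Y.qa c hc := by
  ext y
  induction y using QuotientAddGroup.induction_on with | H y => ?_
  rw [qa_mk, qa_mk]
  have hy : (y : Y.G) - (c + Y.f) ∉ Y.G₀ := fun h => hc' (by simpa using Y.G₀.sub_mem y.2 h)
  rw [← Y.q_add_f hy]
  congr 1
  abel

end Lift

theorem card_hom_mapD_eq (ψ : X.D ≃+ Y.D) (hψ : Y.qClass.comap ψ = X.qClass) :
    Nat.card {φ : Hom X Y // φ.mapD = ψ} = 2 := by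
  obtain ⟨a, ha⟩ := X.exists_notMem
  -- The transport of `q_a` along `ψ` lies in the class of `Y`, hence is some `q_c`; the lifts of
  -- `ψ` correspond to the images `c` and `c + f` of `a`.
  have hcls : QuadClass.mk ((X.qa a ha).comap ψ.symm) = Y.qClass := by
    rw [← QuadClass.comap_mk, X.mk_qa, ← hψ, ← QuadClass.comap_trans, AddEquiv.symm_trans_self,
      QuadClass.comap_refl]
  obtain ⟨c, hc, hq⟩ := Y.exists_eq_qa hcls
  have hψc : ∀ d, Y.qa c hc (ψ d) = X.qa a ha d := fun d => by
    rw [← hq]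
    change X.qa a ha (ψ.symm (ψ d)) = _
    rw [AddEquiv.symm_apply_apply]
  have hcf : c + Y.f ∉ Y.G₀ := fun h => hc ((Y.G₀.add_mem_cancel_right Y.f_mem).1 h)
  have hψf : ∀ d, Y.qa (c + Y.f) hcf (ψ d) = X.qa a ha d := fun d => by
    rw [qa_add_f hc, hψc]
  obtain ⟨φ, h₁, h₂⟩ := exists_hom_of_qa_eq hψc
  obtain ⟨φ', h₁', h₂'⟩ := exists_hom_of_qa_eq hψf
  refine Nat.card_eq_two_iff.2 ⟨⟨φ, h₂⟩, ⟨φ', h₂'⟩, fun h => half_ne_zero ?_, ?_⟩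
  · have h3 : φ = φ' := congrArg Subtype.val h
    rw [h3, h₁'] at h₁
    rw [← Y.q_f, add_eq_left.1 h₁, Y.q_zero]
  · refine Set.eq_univ_of_forall fun k => ?_
    obtain ⟨k, hk⟩ := k
    have hka : k.φ a ∉ Y.G₀ := (k.map_mem_iff a).not.2 ha
    have hqa : Y.qa c hc = Y.qa (k.φ a) hka := by
      rw [← hq, ← k.comap_qa, hk]
      ext d
      change Y.qa _ hka (ψ (ψ.symm d)) = _
      rw [AddEquiv.apply_symm_apply]
    rcases eq_or_eq_add_f hc hka hqa with h | h
    · exact Or.inl (Subtype.ext (Hom.ext_of_mapD_eq ha (h.trans h₁.symm) (hk.trans h₂.symm)))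
    · exact Or.inr (Subtype.ext (Hom.ext_of_mapD_eq ha (h.trans h₁'.symm) (hk.trans h₂'.symm)))

end PSM

/-! ### Divisibility of `ℚ/ℤ`, and auxiliary constructions of quadratic forms. -/

theorem exists_nsmul_eq {n : ℕ} (hn : n ≠ 0) (u : QZ) : ∃ t : QZ, n • t = u := by
  induction u using QuotientAddGroup.induction_on with | H r => ?_
  refine ⟨((r / n : ℚ) : QZ), ?_⟩
  rw [← QuotientAddGroup.mk_nsmul]
  congr 1
  rw [nsmul_eq_mul, mul_div_cancel₀]
  exact Nat.cast_ne_zero.2 hn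

theorem even_of_zsmul_half {n : ℤ} (h : n • half = 0) : Even n := by
  by_contra hn
  obtain ⟨m, rfl⟩ := Int.not_even_iff_odd.1 hn
  refine PSM.half_ne_zero ?_
  rwa [add_zsmul, mul_comm, mul_zsmul, two_zsmul, PSM.half_add_half, smul_zero, zero_add,
    one_zsmul] at h

namespace QuadForm

variable {G : Type u} [AddCommGroup G]

/-- A normalised even quadratic form is homogeneous. -/
theorem homogeneous_of_even {q : QuadForm G} (h0 : q 0 = 0) (hq : ∀ x, q (-x) = q x) :
    q.Homogeneous := by
  have hadd : ∀ x y, q (x + y) = q x + q y + q.b x y := fun x y => by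
    rw [QuadForm.map_add, h0, sub_zero]
  have hb : ∀ x, q.b x x = 2 • q x := fun x => by
    have := hadd x (-x)
    rw [add_neg_cancel, h0, hq, b_neg_right, ← sub_eq_add_neg, eq_comm, sub_eq_zero] at this
    rw [two_nsmul, this]
  have hnat : ∀ (n : ℕ) x, q ((n : ℤ) • x) = (n : ℤ) ^ 2 • q x := by
    intro n x
    induction n with
    | zero => simp [h0]
    | succ n ih =>
      push_cast
      rw [add_zsmul, one_zsmul, hadd, ih, b_zsmul_left, hb]
      module
  intro n x
  obtain ⟨m, rfl | rfl⟩ := Int.eq_nat_or_neg n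
  · exact hnat m x
  · rw [neg_zsmul, hq, hnat, neg_sq]

/-- The form induced on the quotient by a cyclic subgroup generated by an isotropic element of the
radical. -/
def quotient (q : QuadForm G) (hq : q.Homogeneous) (r : G) (hr : q r = 0) (hb : ∀ x, q.b x r = 0) :
    QuadForm (G ⧸ AddSubgroup.zmultiples r) where
  toFun := Quotient.lift q fun x y h => by
    obtain ⟨k, hk⟩ := AddSubgroup.mem_zmultiples_iff.1 (QuotientAddGroup.leftRel_apply.1 h)
    have hy : y = x + k • r := by rw [hk, add_neg_cancel_left]
    rw [hy, hq.map_add, hq, hr, b_zsmul_right, hb]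
    simp
  add_left' := by
    intro x x' y
    induction x using QuotientAddGroup.induction_on with | H x => ?_
    induction x' using QuotientAddGroup.induction_on with | H x' => ?_
    induction y using QuotientAddGroup.induction_on with | H y => ?_
    exact q.add_left' x x' y
  add_right' := by
    intro x y y'
    induction x using QuotientAddGroup.induction_on with | H x => ?_
    induction y using QuotientAddGroup.induction_on with | H y => ?_
    induction y' using QuotientAddGroup.induction_on with | H y' => ?_
    exact q.add_right' x y y'

section Quotient

variable (q : QuadForm G) (hq : q.Homogeneous) (r : G) (hr : q r = 0) (hb : ∀ x, q.b x r = 0)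

theorem quotient_homogeneous : (q.quotient hq r hr hb).Homogeneous := by
  intro n x
  induction x using QuotientAddGroup.induction_on with | H x => ?_
  exact hq n x

end Quotient

/-- The form `q + c`. -/
def addConst (q : QuadForm G) (c : QZ) : QuadForm G where
  toFun x := q x + c
  add_left' x x' y := by
    have := q.add_left' x x' y
    grind
  add_right' x x' y := by
    have := q.add_right' x x' y
    grind

theorem addConst_apply (q : QuadForm G) (c : QZ) (x : G) : q.addConst c x = q x + c := rfl

theorem addConst_b (q : QuadForm G) (c : QZ) : (q.addConst c).b = q.b := by
  ext x y
  simp only [b, addConst_apply]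
  abel

theorem gaussSum_addConst [Finite G] (q : QuadForm G) (c : QZ) :
    (q.addConst c).gaussSum = expQZ c * q.gaussSum := by
  have := Fintype.ofFinite G
  rw [gaussSum_eq, gaussSum_eq, mul_left_comm]
  simp only [addConst_apply, expQZ_add, mul_comm (expQZ c), Finset.sum_mul]

end QuadForm

/-- A quadratic form on `D` with its characteristic element `w`, subject to the two relations
which make it come from a pointed spin-modular datum. -/
structure CharForm (D : Type u) [AddCommGroup D] where
  q : QuadForm D
  nondegenerate : q.Nondegenerate
  w : D
  sub_neg : ∀ x, q x - q (-x) = q.b w x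
  q_neg_w : q (-w) = q 0
  eight_nsmul : 8 • q 0 = q.b w w

/-! ### Reconstruction of `(G, q̂, f)` from a form on `𝒟`. -/

namespace CharForm

variable {D : Type u} [AddCommGroup D] (c : CharForm D)

/-- The triples `(x, t, n)` with `2t = -b(w, x)`. -/
def K : AddSubgroup (D × QZ × ℤ) where
  carrier := {p | p.2.1 + p.2.1 + c.q.b c.w p.1 = 0}
  zero_mem' := by simp [QuadForm.b_zero_right]
  add_mem' := by
    intro p p' h h'
    simp only [Set.mem_ofPred_eq, Prod.fst_add, Prod.snd_add, QuadForm.b_add_right] at h h' ⊢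
    grind
  neg_mem' := by
    intro p h
    simp only [Set.mem_ofPred_eq, Prod.fst_neg, Prod.snd_neg, QuadForm.b_neg_right] at h ⊢
    grind

theorem mem_K (p : D × QZ × ℤ) : p ∈ c.K ↔ p.2.1 + p.2.1 + c.q.b c.w p.1 = 0 := Iff.rfl

/-- The form `(x, t, n) ↦ q(x) - q(0) + t + n t + n² q(0)`. -/
def Q : QuadForm c.K where
  toFun p := c.q p.1.1 - c.q 0 + p.1.2.1 + p.1.2.2 • p.1.2.1 + p.1.2.2 ^ 2 • c.q 0
  add_left' x y z := by
    simp only [AddSubgroup.coe_add, Prod.fst_add, Prod.snd_add, AddSubgroup.coe_zero, Prod.fst_zero,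
      Prod.snd_zero, QuadForm.map_add, QuadForm.b_add_left]
    module
  add_right' x y z := by
    simp only [AddSubgroup.coe_add, Prod.fst_add, Prod.snd_add, AddSubgroup.coe_zero, Prod.fst_zero,
      Prod.snd_zero, QuadForm.map_add, QuadForm.b_add_right]
    module

theorem Q_apply (p : c.K) :
    c.Q p = c.q p.1.1 - c.q 0 + p.1.2.1 + p.1.2.2 • p.1.2.1 + p.1.2.2 ^ 2 • c.q 0 := rfl

theorem Q_b (p p' : c.K) : c.Q.b p p' =
    c.q.b p.1.1 p'.1.1 + p.1.2.2 • p'.1.2.1 + p'.1.2.2 • p.1.2.1 +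
      (2 * p.1.2.2 * p'.1.2.2) • c.q 0 := by
  rw [QuadForm.b]
  simp only [Q_apply, AddSubgroup.coe_add, Prod.fst_add, Prod.snd_add, AddSubgroup.coe_zero,
    Prod.fst_zero, Prod.snd_zero, QuadForm.map_add]
  module

theorem Q_homogeneous : c.Q.Homogeneous := by
  refine QuadForm.homogeneous_of_even (by simp [Q_apply]) fun p => ?_
  have h := (c.mem_K _).1 p.2
  have h' := c.sub_neg p.1.1
  simp only [Q_apply, AddSubgroup.coe_neg, Prod.fst_neg, Prod.snd_neg]
  rw [← h', ← two_zsmul] at h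
  have h2 : c.q (-p.1.1) = c.q p.1.1 + (2 : ℤ) • p.1.2.1 := by
    rw [← sub_eq_zero, ← neg_eq_zero, ← h]
    abel
  rw [h2]
  module

/-- The relation `(w, -4 q(0), 2)`. -/
def r : c.K := ⟨(c.w, -(4 • c.q 0), 2), by
  rw [mem_K]
  simp only [← c.eight_nsmul]
  module⟩

/-- The relations on `w` give `q(w) - q(0) = b(w, w) = 8 q(0)`, and the remaining terms are `-4 q(0)
- 8 q(0) + 4 q(0)`. -/
theorem Q_r : c.Q c.r = 0 := by
  have h := c.sub_neg c.w
  rw [c.q_neg_w, ← c.eight_nsmul] at h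
  rw [Q_apply]
  simp only [r]
  rw [h]
  module

theorem Q_b_r (p : c.K) : c.Q.b p c.r = 0 := by
  have h := (c.mem_K _).1 p.2
  rw [Q_b]
  simp only [r]
  rw [← h, c.q.b_comm c.w]
  module

/-- The group `G` of the datum. -/
abbrev G : Type u := c.K ⧸ AddSubgroup.zmultiples c.r

/-- The quadratic form of the datum. -/
def qG : QuadForm c.G := c.Q.quotient c.Q_homogeneous c.r c.Q_r c.Q_b_r

theorem exists_t (x : D) : ∃ t : QZ, t + t + c.q.b c.w x = 0 := by
  obtain ⟨t, ht⟩ := exists_nsmul_eq two_ne_zero (-c.q.b c.w x)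
  exact ⟨t, by rw [← two_nsmul, ht, neg_add_cancel]⟩

/-- A chosen `t` with `2t = -b(w, x)`. -/
noncomputable def t (x : D) : QZ := (c.exists_t x).choose

theorem t_spec (x : D) : c.t x + c.t x + c.q.b c.w x = 0 := (c.exists_t x).choose_spec

/-- The element `(0, 1/2, 0)`. -/
noncomputable def fK : c.K := ⟨(0, half, 0), by
  rw [mem_K]
  simp [QuadForm.b_zero_right, PSM.half_add_half]⟩

/-- The element `(0, 0, 1)`. -/
def aK : c.K := ⟨(0, 0, 1), by
  rw [mem_K]
  simp [QuadForm.b_zero_right]⟩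

/-- The element `(x, t(x), 0)`. -/
noncomputable def lift (x : D) : c.K := ⟨(x, c.t x, 0), c.t_spec x⟩

theorem exists_eq_lift (p : c.K) (hp : p.1.2.2 = 0) :
    p = c.lift p.1.1 ∨ p = c.lift p.1.1 + c.fK := by
  obtain ⟨⟨x, s, n⟩, h⟩ := p
  simp only at hp
  subst hp
  have h1 := (c.mem_K _).1 h
  have h2 := c.t_spec x
  simp only at h1
  have h3 : (s - c.t x) + (s - c.t x) = 0 := by
    rw [sub_add_sub_comm, sub_eq_zero]
    exact add_right_cancel (h1.trans h2.symm)
  rcases PSM.eq_zero_or_eq_half _ h3 with h4 | h4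
  · left
    ext <;> simp [lift, sub_eq_zero.1 h4]
  · right
    ext <;> simp [lift, fK, ← h4]

/-- The last coordinate of `r` is `2`, so division with remainder normalises `n`. -/
theorem exists_add_zsmul_r (p : c.K) : ∃ (m : ℤ) (p' : c.K), p = p' + m • c.r ∧
    (p'.1.2.2 = 0 ∨ p'.1.2.2 = 1) := by
  refine ⟨p.1.2.2 / 2, p - (p.1.2.2 / 2) • c.r, by simp, ?_⟩
  simp [r]
  omega

theorem mk_add_zsmul_r (p : c.K) (m : ℤ) :
    (QuotientAddGroup.mk (p + m • c.r) : c.G) = QuotientAddGroup.mk p := by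
  rw [eq_comm, QuotientAddGroup.eq, neg_add_cancel_left]
  exact AddSubgroup.zsmul_mem_zmultiples _ _

/-- This normal form yields finiteness of `G`, although `K` itself is infinite. -/
theorem mk_surjective (g : c.G) :
    ∃ (x : D) (ε δ : Bool), g = QuotientAddGroup.mk
      (c.lift x + (if ε then c.fK else 0) + (if δ then c.aK else 0)) := by
  induction g using QuotientAddGroup.induction_on with | H p => ?_
  obtain ⟨m, p', rfl, h⟩ := c.exists_add_zsmul_r p
  rw [mk_add_zsmul_r]
  have h0 : ∀ p : c.K, p.1.2.2 = 0 →
      ∃ (x : D) (ε : Bool), p = c.lift x + (if ε then c.fK else 0) := fun p hp => by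
    rcases c.exists_eq_lift p hp with h | h
    · exact ⟨_, false, by simpa using h⟩
    · exact ⟨_, true, by simpa using h⟩
  rcases h with h | h
  · obtain ⟨x, ε, h⟩ := h0 p' h
    exact ⟨x, ε, false, by simp [← h]⟩
  · obtain ⟨x, ε, h⟩ := h0 (p' - c.aK) (by simp [aK, h])
    exact ⟨x, ε, true, by simp [← h]⟩

instance [Finite D] : Finite c.G := by
  let Φ : D × Bool × Bool → c.G := fun p => QuotientAddGroup.mk
      (c.lift p.1 + (if p.2.1 then c.fK else 0) + (if p.2.2 then c.aK else 0))
  refine Finite.of_surjective Φ fun g => ?_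
  obtain ⟨x, ε, δ, h⟩ := c.mk_surjective g
  exact ⟨(x, ε, δ), h.symm⟩

theorem Q_b_fK (p : c.K) : c.Q.b p c.fK = p.1.2.2 • half := by
  rw [Q_b]
  simp [fK, QuadForm.b_zero_right]

theorem Q_b_lift (p : c.K) (hp : p.1.2.2 = 0) (x : D) : c.Q.b p (c.lift x) = c.q.b p.1.1 x := by
  rw [Q_b]
  simp [lift, hp]

theorem Q_b_aK (p : c.K) (hp : p.1.2.2 = 0) : c.Q.b p c.aK = p.1.2.1 := by
  rw [Q_b]
  simp [aK, hp, QuadForm.b_zero_right]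

/-- Pairing with `(0, 1/2, 0)` detects the parity of `n`; once `n = 0`, pairing with the lifts of
`D` detects `x` and pairing with `(0, 0, 1)` reads off `t`. -/
theorem qG_nondegenerate : c.qG.Nondegenerate := by
  intro g hg
  induction g using QuotientAddGroup.induction_on with | H p => ?_
  obtain ⟨m, p', rfl, h⟩ := c.exists_add_zsmul_r p
  rw [mk_add_zsmul_r] at hg ⊢
  have hg' : ∀ p, c.Q.b p' p = 0 := fun p => hg (QuotientAddGroup.mk p)
  have h0 : p'.1.2.2 = 0 := by
    have := c.Q_b_fK p'
    rw [hg'] at this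
    have := even_of_zsmul_half this.symm
    rcases h with h | h
    · exact h
    · rw [h] at this
      exact absurd this (by decide)
  have hx : p'.1.1 = 0 := c.nondegenerate _ fun y => by rw [← c.Q_b_lift p' h0, hg']
  have ht : p'.1.2.1 = 0 := by rw [← c.Q_b_aK p' h0, hg']
  have : p' = 0 := by ext <;> simp [hx, ht, h0]
  rw [this, QuotientAddGroup.mk_zero]

variable [Finite D]

/-- The pointed spin-modular datum constructed from the form. -/
noncomputable def toPSM : PSM.{u} where
  G := c.G
  q := c.qG
  homogeneous := c.Q.quotient_homogeneous _ _ _ _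
  nondegenerate := c.qG_nondegenerate
  f := QuotientAddGroup.mk c.fK
  two_f := by
    have : 2 • c.fK = 0 := by ext <;> simp [fK, two_nsmul, PSM.half_add_half]
    rw [← QuotientAddGroup.mk_nsmul, this, QuotientAddGroup.mk_zero]
  q_f := by
    change c.Q c.fK = half
    simp [Q_apply, fK]

theorem mk_mem_iff (p : c.K) : (QuotientAddGroup.mk p : c.G) ∈ c.toPSM.G₀ ↔ Even p.1.2.2 := by
  change c.Q.b p c.fK = 0 ↔ _
  rw [Q_b_fK]
  refine ⟨even_of_zsmul_half, ?_⟩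
  rintro ⟨m, hm⟩
  rw [hm, add_zsmul, ← zsmul_add, PSM.half_add_half, smul_zero]

/-- The element `[(0, 0, 1)]`. -/
noncomputable def a : c.toPSM.G := (QuotientAddGroup.mk c.aK : c.G)

theorem a_notMem : c.a ∉ c.toPSM.G₀ := fun h =>
  (by decide : ¬Even (1 : ℤ)) ((c.mk_mem_iff c.aK).1 h)

/-- The element of `G₀` represented by `p`. -/
noncomputable def mk₀ (p : c.K) (hp : p.1.2.2 = 0) : c.toPSM.G₀ :=
  ⟨(QuotientAddGroup.mk p : c.G), (c.mk_mem_iff p).2 (by rw [hp]; exact Even.zero)⟩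

/-- The map `x ↦ [(x, t(x), 0)]`. -/
noncomputable def δ (x : D) : c.toPSM.D := QuotientAddGroup.mk (c.mk₀ (c.lift x) rfl)

/-- Two solutions `t` of `2t = -b(w, x)` differ by `0` or `1/2`, so passing to the quotient by `f`
forgets `t`. In particular the arbitrary choice of `t(x)` still makes `δ` additive. -/
theorem mk_mk₀ (p : c.K) (hp : p.1.2.2 = 0) :
    (QuotientAddGroup.mk (c.mk₀ p hp) : c.toPSM.D) = c.δ p.1.1 := by
  rw [δ, ← sub_eq_zero, ← QuotientAddGroup.mk_sub]
  refine c.toPSM.mk_eq_zero.2 ?_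
  change (QuotientAddGroup.mk (p - c.lift p.1.1) : c.G) = 0 ∨
    (QuotientAddGroup.mk (p - c.lift p.1.1) : c.G) = QuotientAddGroup.mk c.fK
  rcases c.exists_eq_lift p hp with h | h
  · left
    rw [← h, sub_self, QuotientAddGroup.mk_zero]
  · right
    congr 1
    exact sub_eq_iff_eq_add'.2 h

theorem δ_add (x y : D) : c.δ (x + y) = c.δ x + c.δ y := by
  have h := c.mk_mk₀ (c.lift x + c.lift y) (by simp [lift])
  exact h.symm

/-- Here `n = -1`, so the two terms in `t` cancel and `n² q(0)` cancels `-q(0)`. -/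
theorem qa_δ (x : D) : c.toPSM.qa c.a c.a_notMem (c.δ x) = c.q x := by
  change c.Q (c.lift x - c.aK) = c.q x
  simp only [Q_apply, lift, aK, AddSubgroup.coe_sub, Prod.fst_sub, Prod.snd_sub]
  simp

theorem δ_surjective : Function.Surjective c.δ := by
  intro d
  induction d using QuotientAddGroup.induction_on with | H g => ?_
  obtain ⟨g, hg⟩ := g
  obtain ⟨p, rfl⟩ := QuotientAddGroup.mk_surjective (s := AddSubgroup.zmultiples c.r) g
  obtain ⟨m, p', rfl, h⟩ := c.exists_add_zsmul_r p
  have hp := (c.mk_mem_iff _).1 ((c.mk_add_zsmul_r p' m) ▸ hg)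
  have h0 : p'.1.2.2 = 0 := by
    rcases h with h | h
    · exact h
    · rw [h] at hp
      exact absurd hp (by decide)
  refine ⟨p'.1.1, ?_⟩
  rw [← c.mk_mk₀ p' h0]
  congr 1
  exact Subtype.ext (c.mk_add_zsmul_r p' m).symm

/-- The isomorphism of `D` with `G₀ / ⟨f⟩`. -/
noncomputable def δEquiv : D ≃+ c.toPSM.D :=
  AddEquiv.ofBijective (AddMonoidHom.mk' c.δ c.δ_add)
    ⟨(injective_iff_map_eq_zero _).2 fun x hx => c.nondegenerate x fun y => by
      have h : ∀ z, c.q z = c.toPSM.qa c.a c.a_notMem (AddMonoidHom.mk' c.δ c.δ_add z) :=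
        fun z => (c.qa_δ z).symm
      rw [QuadForm.b, h, h, h, h, map_add, hx, map_zero]
      simp,
    c.δ_surjective⟩

theorem comap_δEquiv : (c.toPSM.qa c.a c.a_notMem).comap c.δEquiv = c.q :=
  QuadForm.ext (funext c.qa_δ)

theorem gaussSum_pow_eight : c.q.gaussSum ^ 8 = 1 := by
  rw [← c.comap_δEquiv, QuadForm.gaussSum_comap, PSM.gaussSum_qa,
    c.toPSM.homogeneous.gaussSum_pow_eight c.toPSM.nondegenerate]

end CharForm

/-! ### The characteristic element and the Gauss–Milgram constraint. -/

namespace QuadForm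

variable {D : Type u} [AddCommGroup D] [Finite D] {q : QuadForm D}

theorem Nondegenerate.exists_sub_neg_eq (hq : q.Nondegenerate) :
    ∃ w, ∀ x, q x - q (-x) = q.b w x := by
  refine hq.exists_b_eq (AddMonoidHom.mk' (fun x => q x - q (-x)) fun x y => ?_)
  rw [neg_add, QuadForm.map_add, QuadForm.map_add, b_neg_left, b_neg_right]
  abel

/-- The reflection `x ↦ -w - x` changes `q` by the constant `q(-w) - q(0)`, which is `0` or `1/2`.
In the latter case the Gauss sum equals its own negative, but it is nonzero. -/
theorem Nondegenerate.map_neg_eq (hq : q.Nondegenerate) {w : D}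
    (hw : ∀ x, q x - q (-x) = q.b w x) : q (-w) = q 0 := by
  have := Fintype.ofFinite D
  have h1 : ∀ x, q (-w - x) = (q (-w) - q 0) + q x := fun x => by
    have h := hw x
    rw [sub_eq_add_neg, QuadForm.map_add, b_neg_right, b_neg_left, neg_neg, ← h]
    abel
  have h2 : (q (-w) - q 0) + (q (-w) - q 0) = 0 := by
    have h := h1 (-w)
    rw [sub_self] at h
    rw [← add_sub_assoc, ← h, sub_self]
  rcases PSM.eq_zero_or_eq_half _ h2 with h | h
  · exact sub_eq_zero.1 h
  · exfalso
    have hsum : ∑ x, expQZ (q x) = -∑ x, expQZ (q x) := by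
      rw [← Finset.sum_neg_distrib]
      rw [← Equiv.sum_comp (Equiv.subLeft (-w)) fun x => expQZ (q x)]
      refine Finset.sum_congr rfl fun x _ => ?_
      rw [Equiv.subLeft_apply, h1, h, expQZ_add, expQZ_half, neg_one_mul]
    refine hq.gaussSum_ne_zero ?_
    rw [gaussSum_eq, self_eq_neg.1 hsum, mul_zero]

/-- A non-degenerate form whose Gauss sum is an eighth root of unity comes from a pointed
spin-modular datum. -/
theorem Nondegenerate.exists_charForm (hq : q.Nondegenerate) (h8 : q.gaussSum ^ 8 = 1) :
    ∃ c : CharForm D, c.q = q := by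
  obtain ⟨w, hw⟩ := hq.exists_sub_neg_eq
  -- The constant `s` forces the relation `8 q(0) = b(w, w)` on `q + s`, which therefore comes from
  -- a datum.
  obtain ⟨s, hs⟩ := exists_nsmul_eq (n := 8) (by norm_num) (q.b w w - 8 • q 0)
  have hn : (q.addConst s).Nondegenerate := fun x hx => hq x fun y => by
    rw [← q.addConst_b s, hx]
  let c : CharForm D :=
    { q := q.addConst s
      nondegenerate := hn
      w := w
      sub_neg := fun x => by
        rw [addConst_b, ← hw, addConst_apply, addConst_apply, add_sub_add_right_eq_sub]
      q_neg_w := by rw [addConst_apply, addConst_apply, hq.map_neg_eq hw]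
      eight_nsmul := by rw [addConst_b, addConst_apply, nsmul_add, hs, add_sub_cancel] }
  -- Both `q` and `q + s` have Gauss sums that are eighth roots of unity, so `8 s = 0` and `q`
  -- already satisfies the relation.
  have hc := c.gaussSum_pow_eight
  change (q.addConst s).gaussSum ^ 8 = 1 at hc
  rw [gaussSum_addConst, mul_pow, h8, mul_one, ← expQZ_nsmul] at hc
  rw [eq_zero_of_expQZ_eq_one hc, eq_comm, sub_eq_zero] at hs
  exact ⟨⟨q, hq, w, hw, hq.map_neg_eq hw, hs.symm⟩, rfl⟩

end QuadForm

/-! ### Categorical consequences and spin objects. -/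

section Generalities

variable {C : Type*} [Category C] {C' : Type*} [Category C'] {F : C ⥤ C'}

theorem TwoToOneOnHoms.full (h : TwoToOneOnHoms F) : F.Full where
  map_surjective {X Y} g := by
    have : Nonempty {k : X ⟶ Y // F.map k = g} :=
      (Nat.card_pos_iff.1 (by rw [h X Y g]; exact two_pos)).1
    obtain ⟨k, hk⟩ := this
    exact ⟨k, hk⟩

/-- No faithfulness is needed: in a groupoid any preimage of an isomorphism is an isomorphism. -/
theorem bijective_mapIsoClasses [IsGroupoid C] [F.EssSurj] [F.Full] :
    Function.Bijective (mapIsoClasses F) := by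
  constructor
  · intro x y
    induction x using Quotient.inductionOn with | h X => ?_
    induction y using Quotient.inductionOn with | h Y => ?_
    intro h
    obtain ⟨e⟩ := Quotient.exact h
    exact Quotient.sound ⟨asIso (F.preimage e.hom)⟩
  · intro y
    induction y using Quotient.inductionOn with | h Y => ?_
    exact ⟨Quotient.mk _ (F.objPreimage Y), Quotient.sound ⟨F.objObjPreimageIso Y⟩⟩

variable {P : ObjectProperty C} {P' : ObjectProperty C'}

theorem TwoToOneOnHoms.restrict (h : TwoToOneOnHoms F) (hP : ∀ X, P X → P' (F.obj X)) :
    TwoToOneOnHoms (P'.lift (P.ι ⋙ F) fun X => hP X.obj X.property) := by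
  intro X Y g
  rw [← h X.obj Y.obj g.hom]
  refine Nat.card_congr ⟨fun k => ⟨k.1.hom, congrArg (fun f => f.hom) k.2⟩,
    fun k => ⟨ObjectProperty.homMk k.1, ObjectProperty.hom_ext _ k.2⟩, fun _ => rfl, fun _ => rfl⟩

theorem essSurj_restrict [F.EssSurj] [P'.IsClosedUnderIsomorphisms]
    (hP : ∀ X, P X ↔ P' (F.obj X)) :
    (P'.lift (P.ι ⋙ F) fun X => (hP X.obj).1 X.property).EssSurj where
  mem_essImage Y := by
    have e := F.objObjPreimageIso Y.obj
    exact ⟨⟨F.objPreimage Y.obj, (hP _).2 (P'.prop_of_iso e.symm Y.property)⟩,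
      ⟨P'.isoMk e⟩⟩

instance [IsGroupoid C] : IsGroupoid P.FullSubcategory where
  all_isIso f := (P.isIso_hom_iff f).1 inferInstance

end Generalities

instance : ASCS.isSpin.{u}.IsClosedUnderIsomorphisms where
  of_iso {X Y} e hX q hq := by
    let f : ASCS.Hom X Y := e.hom
    have h := hX (q.comap f.φ) (by rw [← QuadClass.comap_mk, hq, f.map_cls])
    change q (f.φ 0) ≠ 0 at h
    rwa [map_zero] at h

theorem twoToOneOnHoms_F : TwoToOneOnHoms (F wellDefined.{u}) := by
  intro X Y g
  rw [← PSM.card_hom_mapD_eq (ASCS.Hom.φ g) (ASCS.Hom.map_cls g)]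
  exact Nat.card_congr (Equiv.subtypeEquivRight fun k => ASCS.Hom.ext_iff)

instance : (F wellDefined.{u}).EssSurj where
  mem_essImage Y := by
    obtain ⟨q, hq⟩ := Quotient.exists_rep Y.cls
    obtain ⟨c, rfl⟩ := (Y.nondegenerate q hq).exists_charForm (by
      rw [Y.gaussMilgram q hq, stdAddChar_pow_eight])
    -- Only the classes have to match: `σ` is determined by the Gauss sum.
    let f : ASCS.Hom Y ((F wellDefined).obj c.toPSM) := ⟨c.δEquiv, by
      change c.toPSM.qClass.comap c.δEquiv = Y.cls
      rw [← c.toPSM.mk_qa c.a c.a_notMem, QuadClass.comap_mk, c.comap_δEquiv]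
      exact hq⟩
    exact ⟨c.toPSM, ⟨(asIso (show Y ⟶ (F wellDefined).obj c.toPSM from f)).symm⟩⟩

/-- The representatives are the `q_c` with `c ∉ G₀`, and `q_c(0) = q̂(-c) = q̂(c)`. -/
theorem isSpin_iff (X : PSM.{u}) : PSM.isSpin X ↔ ASCS.isSpin ((F wellDefined).obj X) := by
  constructor
  · intro h q hq
    obtain ⟨c, hc, rfl⟩ := X.exists_eq_qa hq
    change X.q (0 - c) ≠ 0
    rw [zero_sub, X.homogeneous.map_neg]
    exact h c hc
  · intro h g hg
    have h' : X.q (0 - g) ≠ 0 := h (X.qa g hg) (X.mk_qa g hg)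
    rwa [zero_sub, X.homogeneous.map_neg] at h'

end SpinCS

theorem mainTheorem7 :
    ∃ h : SpinCS.WellDefined.{u},
      ((SpinCS.F h).EssSurj ∧ (SpinCS.F h).Full ∧ SpinCS.TwoToOneOnHoms (SpinCS.F h) ∧
        Function.Bijective (SpinCS.mapIsoClasses (SpinCS.F h))) ∧
      ∃ hs : ∀ X : SpinCS.PSM.{u},
          SpinCS.PSM.isSpin X ↔ SpinCS.ASCS.isSpin ((SpinCS.F h).obj X),
        (SpinCS.Fspin h (fun X => (hs X).1)).EssSurj ∧
        (SpinCS.Fspin h (fun X => (hs X).1)).Full ∧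
        SpinCS.TwoToOneOnHoms (SpinCS.Fspin h (fun X => (hs X).1)) ∧
        Function.Bijective (SpinCS.mapIsoClasses (SpinCS.Fspin h (fun X => (hs X).1))) := by
  have full := SpinCS.twoToOneOnHoms_F.{u}.full
  have two : SpinCS.TwoToOneOnHoms
      (SpinCS.Fspin SpinCS.wellDefined.{u} fun X => (SpinCS.isSpin_iff X).1) :=
    SpinCS.twoToOneOnHoms_F.restrict fun X => (SpinCS.isSpin_iff X).1
  have full' := two.full
  have surj : (SpinCS.Fspin SpinCS.wellDefined.{u} fun X => (SpinCS.isSpin_iff X).1).EssSurj :=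
    SpinCS.essSurj_restrict SpinCS.isSpin_iff
  exact ⟨SpinCS.wellDefined, ⟨inferInstance, full, SpinCS.twoToOneOnHoms_F,
    SpinCS.bijective_mapIsoClasses⟩, SpinCS.isSpin_iff, surj, full', two,
    SpinCS.bijective_mapIsoClasses⟩
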